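/- Let $H$ be a separable (real or complex) Hilbert space and let $A$ be a (possibly unbounded) self-adjoint operator in $H$ with domain $D(A)$ which is positive, $(Ax,x)>0$ for $0\neq x\in D(A)$, and which has a complete orthonormal system of eigenvectors: there is a finite or countable orthonormal basis $(v_k)$ of $H$ with $v_k\in D(A)$ and $Av_k=\lambda_kv_k$ (so $\lambda_k>0$). Let $0<\rho\le 1$ and $T>0$. For $\sigma>0$ write $\partial_t^{-\sigma}h(t)=\frac1{\Gamma(\sigma)}\int_0^t(t-\xi)^{\sigma-1}h(\xi)\,d\xi$ (Bochner integral, when it exists), write $\partial_t^{0}h=h$, and let $\partial_t^{\rho}h=\frac{d}{dt}\partial_t^{\rho-1}h$ be the Riemann–Liouville derivative (strong derivative, one-sided at $t=T$); for $\rho=1$ it is the ordinary derivative. Let $E_{\rho,\mu}(x)=\sum_{j=0}^\infty \frac{x^j}{\Gamma(\rho j+\mu)}$. For $\varphi\in H$, a solution of the forward problem $$\partial_t^\rho u(t)+Au(t)=0\quad(0<t\le T),\qquad \lim_{t\to0+}\partial_t^{\rho-1}u(t)=\varphi$$ is a function $u:(0,T]\to H$ for which $\partial_t^\rho u$ and $Au$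 exist on $(0,T]$ (so $u(t)\in D(A)$ there), belong to $C((0,T];H)$, and satisfy both conditions. Then for every $\varphi\in H$ the forward problem has a unique solution, and it is given by $$u(t)=\sum_k t^{\rho-1}E_{\rho,\rho}(-\lambda_kt^\rho)\,(\varphi,v_k)\,v_k,\qquad 0<t\le T,$$ the series converging (unconditionally) in the norm of $H$. -/

import Mathlib

open Set Filter Topology MeasureTheory

noncomputable section

/-- The two-parameter Mittag-Leffler function
`E_{ρ,μ}(x) = ∑_{k ≥ 0} x ^ k / Γ(ρ k + μ)` of a real argument
(the series converges absolutely for every real `x` when `ρ, μ > 0`). -/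
def mittagLeffler (ρ μ x : ℝ) : ℝ :=
  ∑' k : ℕ, x ^ k / Real.Gamma (ρ * k + μ)

section Fractional

variable {E : Type*} [NormedAddCommGroup E] [NormedSpace ℝ E]

/-- The fractional integral `∂_t^{-σ} h` of order `σ ≥ 0`, as a Bochner integral:
`(1 / Γ(σ)) ∫_0^t (t - ξ) ^ (σ - 1) h(ξ) dξ` for `σ > 0`, and `h` itself for `σ = 0`. -/
def fracIntegral (σ : ℝ) (h : ℝ → E) (t : ℝ) : E :=
  if σ = 0 then h t
  else (Real.Gamma σ)⁻¹ • ∫ ξ in (0 : ℝ)..t, (t - ξ) ^ (σ - 1) • h ξ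

/-- The fractional integral of order `σ` of `h` exists at the time `t`:
for `σ ≠ 0` the integrand is Bochner integrable on `(0, t)`. -/
def FracIntegrableAt (σ : ℝ) (h : ℝ → E) (t : ℝ) : Prop :=
  σ ≠ 0 → IntervalIntegrable (fun ξ : ℝ => (t - ξ) ^ (σ - 1) • h ξ) volume 0 t

/-- The Riemann-Liouville derivative `∂_t^ρ h = (d/dt) ∂_t^{ρ-1} h`, `0 < ρ ≤ 1`, of a function
on `(0, T]`; at the endpoint `t = T` the strong derivative `d/dt` is the one-sided one. -/
def rlDeriv (ρ T : ℝ) (h : ℝ → E) (t : ℝ) : E :=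
  derivWithin (fracIntegral (1 - ρ) h) (Ioc 0 T) t

end Fractional

/-- `u` is a solution of the forward problem
`∂_t^ρ u(t) + A u(t) = 0` for `0 < t ≤ T`, `lim_{t → 0} ∂_t^{ρ-1} u(t) = φ`:
`∂_t^ρ u` and `A u` exist and belong to `C((0, T]; H)`, and both conditions hold.
Only the values of `u` on `(0, T]` matter. -/
structure IsForwardSolution {𝕜 H : Type*} [RCLike 𝕜] [NormedAddCommGroup H]
    [InnerProductSpace 𝕜 H] [NormedSpace ℝ H]
    (A : H →ₗ.[𝕜] H) (ρ T : ℝ) (φ : H) (u : ℝ → H) : Prop where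
  fracIntegrable : ∀ t ∈ Ioc 0 T, FracIntegrableAt (1 - ρ) u t
  differentiable : DifferentiableOn ℝ (fracIntegral (1 - ρ) u) (Ioc 0 T)
  continuous_rlDeriv : ContinuousOn (rlDeriv ρ T u) (Ioc 0 T)
  mem_domain : ∀ t ∈ Ioc 0 T, u t ∈ A.domain
  continuous_apply : Continuous fun t : Ioc 0 T => A ⟨u t, mem_domain t t.2⟩
  equation : ∀ (t : ℝ) (ht : t ∈ Ioc 0 T), rlDeriv ρ T u t + A ⟨u t, mem_domain t ht⟩ = 0
  initial : Tendsto (fracIntegral (1 - ρ) u) (𝓝[>] 0) (𝓝 φ)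

end

/-! Pairing with `v i` reduces the problem to scalar relaxation equations ∂^ρ y + λ y = 0, solved by
multiples of e(t) = t^(ρ-1) E_{ρ,ρ}(-λ t^ρ), i.e. `mlRelaxation ρ ρ λ`. The eigenvalues may be
unbounded and φ is arbitrary, so what matters is control of e and λe at each t > 0 uniformly in λ.

The bounds are 0 ≤ e(t) ≤ t^(ρ-1)/Γ(ρ), 0 ≤ E_{ρ,1}(-λ t^ρ) ≤ 1 and λ e(t) ≤ 1/t. They all rest on e
≥ 0 (`mlRelaxation_nonneg`), which is read off the Volterra equation Γ(ρ) e(t) + λ ∫ (t-ξ)^(ρ-1)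
e(ξ) dξ = t^(ρ-1). The third also needs the convolution identity `mul_mlRelaxation_eq_integral`.

Existence: bounded coefficients define bounded diagonal operators, strongly continuous in t by
Parseval and dominated convergence (`tendsto_diagonalSum`). Self-adjointness makes membership in
D(A) a condition on coefficients (`exists_mem_domain_apply_eq`). The series is never differentiated
termwise: the increments of ∂^(ρ-1) u are integrals of -Au, and the fundamental theorem of calculus
applies.

Uniqueness: each coefficient of a difference of two solutions solves the scalar equation with zero
data. Its primitive then satisfies a homogeneous Volterra equation and vanishes
(`eqOn_zero_of_fracIntegral_relaxation`). -/

/-! ### Beta integrals -/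

theorem integral_sub_rpow_mul_rpow {a b t : ℝ} (ha : 0 < a) (hb : 0 < b) (ht : 0 < t) :
    ∫ ξ in (0 : ℝ)..t, (t - ξ) ^ (a - 1) * ξ ^ (b - 1)
      = t ^ (a + b - 1) * (Real.Gamma a * Real.Gamma b / Real.Gamma (a + b)) := by
  have h1 := Complex.betaIntegral_scaled (b : ℂ) (a : ℂ) ht
  have h2 : ∫ x in (0 : ℝ)..t, (x : ℂ) ^ ((b : ℂ) - 1) * ((t : ℂ) - x) ^ ((a : ℂ) - 1)
      = ∫ x in (0 : ℝ)..t, (((t - x) ^ (a - 1) * x ^ (b - 1) : ℝ) : ℂ) := by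
    refine intervalIntegral.integral_congr fun x hx => ?_
    rw [uIcc_of_le ht.le] at hx
    rw [Complex.ofReal_mul, Complex.ofReal_cpow (sub_nonneg.2 hx.2), Complex.ofReal_cpow hx.1]
    push_cast
    ring
  rw [h2, intervalIntegral.integral_ofReal, Complex.betaIntegral_eq_Gamma_mul_div _ _
    (by simpa using hb) (by simpa using ha)] at h1
  apply Complex.ofReal_injective
  rw [h1]
  push_cast
  rw [Complex.ofReal_cpow ht.le, ← Complex.Gamma_ofReal, ← Complex.Gamma_ofReal,
    ← Complex.Gamma_ofReal]
  push_cast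
  rw [add_comm (b : ℂ), mul_comm (Complex.Gamma b)]

theorem intervalIntegrable_sub_rpow_mul_rpow {a b t : ℝ} (ha : 0 < a) (hb : 0 < b) (ht : 0 < t) :
    IntervalIntegrable (fun ξ : ℝ => (t - ξ) ^ (a - 1) * ξ ^ (b - 1)) volume 0 t := by
  -- A non-integrable function has Bochner integral 0, so the positive value just computed already
  -- gives integrability.
  apply intervalIntegral.intervalIntegrable_of_integral_ne_zero
  rw [integral_sub_rpow_mul_rpow ha hb ht]
  have := Real.Gamma_pos_of_pos ha
  have := Real.Gamma_pos_of_pos hb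
  have := Real.Gamma_pos_of_pos (add_pos ha hb)
  positivity

/-! ### Growth of Gamma and the Mittag-Leffler series -/

/-- Keep only the piece (M, M + 1] of Euler's integral. Since M is arbitrary, Γ outgrows every
geometric sequence, with no appeal to Stirling. -/
theorem rpow_le_const_mul_Gamma {M x : ℝ} (hM : 1 ≤ M) (hx : 0 < x) :
    M ^ x ≤ Real.exp (M + 1) * (M + 1) * Real.Gamma x := by
  have hM0 : 0 < M := by linarith
  have key : Real.exp (-(M + 1)) * (M ^ x / (M + 1)) ≤ Real.Gamma x := by
    rw [Real.Gamma_eq_integral hx]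
    have hI := Real.GammaIntegral_convergent hx
    have hsub : Ioc M (M + 1) ⊆ Ioi 0 := fun y hy => hM0.trans hy.1
    calc Real.exp (-(M + 1)) * (M ^ x / (M + 1))
        = ∫ _ in Ioc M (M + 1), Real.exp (-(M + 1)) * (M ^ x / (M + 1)) := by simp
      _ ≤ ∫ y in Ioc M (M + 1), Real.exp (-y) * y ^ (x - 1) := by
          refine setIntegral_mono_on (integrableOn_const (by simp)) (hI.mono_set hsub) measurableSet_Ioc fun y hy => ?_
          have hy0 : 0 < y := hM0.trans hy.1
          rw [Real.rpow_sub_one hy0.ne']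
          gcongr
          · exact hy.2
          · exact hy.1.le
          · exact hy.2
      _ ≤ _ := by
          refine setIntegral_mono_set hI ?_ hsub.eventuallyLE
          filter_upwards [ae_restrict_mem measurableSet_Ioi] with y hy
          have : (0 : ℝ) < y := hy
          positivity
  rw [Real.exp_neg] at key
  have h3 := mul_le_mul_of_nonneg_left key
    (by positivity : 0 ≤ Real.exp (M + 1) * (M + 1))
  refine le_trans (le_of_eq ?_) h3
  field_simp

/-- The coefficients of the Mittag-Leffler series, with a polynomial factor allowed, decay faster
than any geometric sequence. -/
theorem summable_mul_pow_div_Gamma {ρ μ : ℝ} (hρ : 0 < ρ) (hμ : 0 < μ) (x : ℝ) :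
    Summable fun n : ℕ => ((n : ℝ) + 1) * |x| ^ n / Real.Gamma (ρ * n + μ) := by
  -- Chosen so that M^ρ ≥ 2|x|: Γ(ρn + μ) then dominates (2|x|)^n up to a constant, leaving the
  -- summable factor (n + 1) 2^(-n).
  set M : ℝ := max 1 ((2 * |x|) ^ (1 / ρ))
  have hM : 1 ≤ M := le_max_left _ _
  have hMρ : 2 * |x| ≤ M ^ ρ := by
    calc 2 * |x| = ((2 * |x|) ^ (1 / ρ)) ^ ρ := by
          rw [← Real.rpow_mul (by positivity), one_div_mul_cancel hρ.ne', Real.rpow_one]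
      _ ≤ M ^ ρ := by gcongr; exact le_max_right _ _
  have hg : Summable fun n : ℕ => ((n : ℝ) + 1) * (1 / 2 : ℝ) ^ n := by
    have h1 := summable_pow_mul_geometric_of_norm_lt_one 1 (r := (1 / 2 : ℝ)) (by norm_num)
    have h2 := summable_geometric_of_norm_lt_one (x := (1 / 2 : ℝ)) (by norm_num)
    refine (h1.add h2).congr fun n => ?_
    ring
  refine Summable.of_nonneg_of_le (fun n => ?_) (fun n => ?_)
    (hg.mul_left (Real.exp (M + 1) * (M + 1)))
  · have := Real.Gamma_pos_of_pos (show 0 < ρ * n + μ by positivity)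
    positivity
  · have hG := Real.Gamma_pos_of_pos (show 0 < ρ * n + μ by positivity)
    rw [div_le_iff₀ hG]
    have h1 := rpow_le_const_mul_Gamma hM (show 0 < ρ * n + μ by positivity)
    have h2 : (2 * |x|) ^ n ≤ M ^ (ρ * n + μ) := by
      calc (2 * |x|) ^ n ≤ (M ^ ρ) ^ n := by gcongr
        _ = M ^ (ρ * n) := by rw [← Real.rpow_natCast, ← Real.rpow_mul (by linarith)]
        _ ≤ M ^ (ρ * n + μ) := Real.rpow_le_rpow_of_exponent_le hM (by linarith)
    have h3 : |x| ^ n = (1 / 2) ^ n * (2 * |x|) ^ n := by rw [← mul_pow]; ring_nf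
    rw [h3]
    calc ((n : ℝ) + 1) * ((1 / 2) ^ n * (2 * |x|) ^ n)
        = (((n : ℝ) + 1) * (1 / 2) ^ n) * (2 * |x|) ^ n := by ring
      _ ≤ (((n : ℝ) + 1) * (1 / 2) ^ n) *
            (Real.exp (M + 1) * (M + 1) * Real.Gamma (ρ * n + μ)) := by
          gcongr; exact h2.trans h1
      _ = _ := by ring

theorem summable_abs_pow_div_Gamma {ρ μ : ℝ} (hρ : 0 < ρ) (hμ : 0 < μ) (x : ℝ) :
    Summable fun n : ℕ => |x| ^ n / Real.Gamma (ρ * n + μ) := by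
  refine Summable.of_nonneg_of_le (fun n => ?_) (fun n => ?_) (summable_mul_pow_div_Gamma hρ hμ x)
  · have := Real.Gamma_pos_of_pos (show 0 < ρ * n + μ by positivity)
    positivity
  · have := Real.Gamma_pos_of_pos (show 0 < ρ * n + μ by positivity)
    gcongr
    nlinarith [pow_nonneg (abs_nonneg x) n, (Nat.cast_nonneg n : (0 : ℝ) ≤ n)]

theorem norm_pow_div_Gamma {ρ μ : ℝ} (hρ : 0 < ρ) (hμ : 0 < μ) (x : ℝ) (n : ℕ) :
    ‖x ^ n / Real.Gamma (ρ * n + μ)‖ = |x| ^ n / Real.Gamma (ρ * n + μ) := by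
  have := Real.Gamma_pos_of_pos (show 0 < ρ * n + μ by positivity)
  rw [norm_div, norm_pow, Real.norm_eq_abs, Real.norm_eq_abs, abs_of_pos this]

theorem hasSum_mittagLeffler {ρ μ : ℝ} (hρ : 0 < ρ) (hμ : 0 < μ) (x : ℝ) :
    HasSum (fun n : ℕ => x ^ n / Real.Gamma (ρ * n + μ)) (mittagLeffler ρ μ x) := by
  refine Summable.hasSum (Summable.of_norm ?_)
  simpa only [norm_pow_div_Gamma hρ hμ] using summable_abs_pow_div_Gamma hρ hμ x

theorem continuous_mittagLeffler {ρ μ : ℝ} (hρ : 0 < ρ) (hμ : 0 < μ) :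
    Continuous (mittagLeffler ρ μ) := by
  rw [continuous_iff_continuousAt]
  intro x
  have h : ContinuousOn (mittagLeffler ρ μ) (Icc (-(|x| + 1)) (|x| + 1)) := by
    refine continuousOn_tsum (fun n => by fun_prop)
      (summable_abs_pow_div_Gamma hρ hμ (|x| + 1)) fun n y hy => ?_
    have := Real.Gamma_pos_of_pos (show 0 < ρ * n + μ by positivity)
    rw [norm_pow_div_Gamma hρ hμ]
    have hle : |y| ≤ |(|x| + 1)| := by
      rw [abs_of_nonneg (by positivity : 0 ≤ |x| + 1)]
      exact abs_le.2 hy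
    exact div_le_div_of_nonneg_right (pow_le_pow_left₀ (abs_nonneg y) hle n) this.le
  refine h.continuousAt (Icc_mem_nhds ?_ ?_)
  · linarith [neg_abs_le x]
  · linarith [le_abs_self x]

theorem mittagLeffler_zero (ρ μ : ℝ) : mittagLeffler ρ μ 0 = (Real.Gamma μ)⁻¹ := by
  rw [mittagLeffler, tsum_eq_single 0]
  · simp
  · intro n hn
    simp [hn]

/-! ### Relaxation functions and their fractional integrals -/

/-- The function `t ↦ t ^ (μ - 1) E_{ρ,μ}(-l t ^ ρ)`. -/
noncomputable def mlRelaxation (ρ μ l t : ℝ) : ℝ := t ^ (μ - 1) * mittagLeffler ρ μ (-l * t ^ ρ)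

theorem mlRelaxation_term {ρ μ l t : ℝ} (ht : 0 < t) (n : ℕ) :
    t ^ (μ - 1) * ((-l * t ^ ρ) ^ n / Real.Gamma (ρ * n + μ))
      = (-l) ^ n * t ^ (ρ * n + μ - 1) / Real.Gamma (ρ * n + μ) := by
  rw [mul_pow, ← Real.rpow_natCast (t ^ ρ), ← Real.rpow_mul ht.le,
    show ρ * n + μ - 1 = (μ - 1) + ρ * n by ring, Real.rpow_add ht]
  ring

theorem hasSum_mlRelaxation {ρ μ t : ℝ} (hρ : 0 < ρ) (hμ : 0 < μ) (l : ℝ) (ht : 0 < t) :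
    HasSum (fun n : ℕ => (-l) ^ n * t ^ (ρ * n + μ - 1) / Real.Gamma (ρ * n + μ))
      (mlRelaxation ρ μ l t) := by
  simpa only [mlRelaxation_term ht, mlRelaxation] using
    (hasSum_mittagLeffler hρ hμ (-l * t ^ ρ)).mul_left (t ^ (μ - 1))

theorem continuousOn_mlRelaxation {ρ μ : ℝ} (hρ : 0 < ρ) (hμ : 0 < μ) (l : ℝ) :
    ContinuousOn (mlRelaxation ρ μ l) (Ioi 0) := by
  refine ContinuousOn.mul ?_ ?_
  · exact continuousOn_id.rpow_const fun x hx => Or.inl (ne_of_gt hx)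
  · exact (continuous_mittagLeffler hρ hμ).comp_continuousOn
      (continuousOn_const.mul (continuousOn_id.rpow_const fun x hx => Or.inl (ne_of_gt hx)))

theorem intervalIntegrable_sub_rpow_mul_mlRelaxation {ρ μ b t : ℝ} (hρ : 0 < ρ) (hμ : 0 < μ)
    (hb : 0 < b) (l : ℝ) (ht : 0 < t) :
    IntervalIntegrable (fun ξ => (t - ξ) ^ (b - 1) * mlRelaxation ρ μ l ξ) volume 0 t := by
  have h := (intervalIntegrable_sub_rpow_mul_rpow hb hμ ht).mul_continuousOn
    (g := fun ξ => mittagLeffler ρ μ (-l * ξ ^ ρ))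
    ((continuous_mittagLeffler hρ hμ).comp_continuousOn
      (continuousOn_const.mul (continuousOn_id.rpow_const fun x _ => Or.inr hρ.le)))
  refine h.congr fun ξ _ => ?_
  simp only [mlRelaxation, mul_assoc]

/-- By the Beta integral, fractional integration of order b sends s^(ν-1)/Γ(ν) to t^(ν+b-1)/Γ(ν+b),
so termwise it only shifts μ. The cases b = ρ, 1 and 1 - ρ give the Volterra equation, the primitive
and the initial datum. -/
theorem integral_sub_rpow_mul_mlRelaxation {ρ μ b t : ℝ} (hρ : 0 < ρ) (hμ : 0 < μ)
    (hb : 0 < b) (l : ℝ) (ht : 0 < t) :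
    ∫ ξ in (0 : ℝ)..t, (t - ξ) ^ (b - 1) * mlRelaxation ρ μ l ξ
      = Real.Gamma b * mlRelaxation ρ (μ + b) l t := by
  have hG : ∀ (n : ℕ) {ν : ℝ}, 0 < ν → 0 < Real.Gamma (ρ * n + ν) := fun n ν hν =>
    Real.Gamma_pos_of_pos (by positivity)
  have hbG := Real.Gamma_pos_of_pos hb
  set F : ℕ → ℝ → ℝ := fun n ξ =>
    (-l) ^ n / Real.Gamma (ρ * n + μ) * ((t - ξ) ^ (b - 1) * ξ ^ (ρ * n + μ - 1)) with hF
  have hFint : ∀ n, Integrable (F n) (volume.restrict (Ioc 0 t)) := fun n =>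
    ((intervalIntegrable_iff_integrableOn_Ioc_of_le ht.le).1
      (intervalIntegrable_sub_rpow_mul_rpow (a := b) (b := ρ * n + μ) hb (by positivity) ht)
        ).const_mul _
  have hval : ∀ (n : ℕ), ∫ ξ in Ioc 0 t, (t - ξ) ^ (b - 1) * ξ ^ (ρ * n + μ - 1)
      = t ^ (ρ * n + (μ + b) - 1) *
        (Real.Gamma b * Real.Gamma (ρ * n + μ) / Real.Gamma (ρ * n + (μ + b))) := fun n => by
    rw [← intervalIntegral.integral_of_le ht.le,
      integral_sub_rpow_mul_rpow (a := b) (b := ρ * n + μ) hb (by positivity) ht,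
      show b + (ρ * n + μ) = ρ * n + (μ + b) by ring]
  have hnorm : ∀ n, ∫ ξ in Ioc 0 t, ‖F n ξ‖
      = Real.Gamma b * t ^ (μ + b - 1) * (|-l * t ^ ρ| ^ n / Real.Gamma (ρ * n + (μ + b))) := by
    intro n
    have h1 : ∫ ξ in Ioc 0 t, ‖F n ξ‖ = ∫ ξ in Ioc 0 t,
        |l| ^ n / Real.Gamma (ρ * n + μ) * ((t - ξ) ^ (b - 1) * ξ ^ (ρ * n + μ - 1)) := by
      refine setIntegral_congr_fun measurableSet_Ioc fun ξ hξ => ?_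
      have h2 : 0 ≤ (t - ξ) ^ (b - 1) := Real.rpow_nonneg (sub_nonneg.2 hξ.2) _
      have h3 : 0 ≤ ξ ^ (ρ * n + μ - 1) := Real.rpow_nonneg hξ.1.le _
      simp only [hF, norm_mul, norm_div, norm_pow, norm_neg, Real.norm_eq_abs]
      rw [abs_of_pos (hG n hμ), abs_of_nonneg h2, abs_of_nonneg h3]
    rw [h1, integral_const_mul, hval, abs_mul, abs_neg, abs_of_nonneg (Real.rpow_nonneg ht.le ρ)]
    -- With -|l| in place of l all terms are nonnegative, so the norms again form a Mittag-Leffler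
    -- series.
    have h4 := mlRelaxation_term (ρ := ρ) (μ := μ + b) (l := -|l|) ht n
    rw [neg_neg] at h4
    rw [mul_assoc, h4]
    have := hG n hμ
    field_simp
  have hsum : Summable fun n => ∫ ξ in Ioc 0 t, ‖F n ξ‖ := by
    simp only [hnorm]
    exact (summable_abs_pow_div_Gamma hρ (by positivity) _).mul_left _
  have key := hasSum_integral_of_summable_integral_norm hFint hsum
  have h5 : ∫ ξ in (0 : ℝ)..t, (t - ξ) ^ (b - 1) * mlRelaxation ρ μ l ξ
      = ∫ ξ in Ioc 0 t, ∑' n, F n ξ := by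
    rw [intervalIntegral.integral_of_le ht.le]
    refine setIntegral_congr_fun measurableSet_Ioc fun ξ hξ => ?_
    have h6 := (hasSum_mlRelaxation hρ hμ l hξ.1).mul_left ((t - ξ) ^ (b - 1))
    rw [← h6.tsum_eq]
    congr 1
    ext n
    simp only [hF]
    ring
  rw [h5, ← key.tsum_eq,
    ← ((hasSum_mlRelaxation hρ (add_pos hμ hb) l ht).mul_left (Real.Gamma b)).tsum_eq]
  refine tsum_congr fun n => ?_
  rw [integral_const_mul, hval]
  have := hG n hμ
  field_simp

theorem mittagLeffler_eq_add {ρ μ : ℝ} (hρ : 0 < ρ) (hμ : 0 < μ) (x : ℝ) :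
    mittagLeffler ρ μ x = (Real.Gamma μ)⁻¹ + x * mittagLeffler ρ (μ + ρ) x := by
  have h := hasSum_mittagLeffler hρ hμ x
  have h2 := (hasSum_mittagLeffler hρ (add_pos hμ hρ) x).mul_left x
  rw [← h.tsum_eq, h.summable.tsum_eq_zero_add, ← h2.tsum_eq]
  congr 1
  · simp
  · congr 1
    ext n
    rw [show ρ * ((n + 1 : ℕ) : ℝ) + μ = ρ * n + (μ + ρ) by push_cast; ring]
    ring

theorem mlRelaxation_eq_sub {ρ μ t : ℝ} (hρ : 0 < ρ) (hμ : 0 < μ) (l : ℝ) (ht : 0 < t) :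
    mlRelaxation ρ μ l t = t ^ (μ - 1) / Real.Gamma μ - l * mlRelaxation ρ (μ + ρ) l t := by
  rw [mlRelaxation, mlRelaxation, mittagLeffler_eq_add hρ hμ,
    show μ + ρ - 1 = (μ - 1) + ρ by ring, Real.rpow_add ht]
  ring

theorem mlRelaxation_one (ρ l t : ℝ) : mlRelaxation ρ 1 l t = mittagLeffler ρ 1 (-l * t ^ ρ) := by
  simp [mlRelaxation]

/-- The Volterra form of the relaxation equation. Its kernel and right side are explicit and
positive, which is what the sign argument uses. -/
theorem Gamma_mul_mlRelaxation_add {ρ t : ℝ} (hρ : 0 < ρ) (l : ℝ) (ht : 0 < t) :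
    Real.Gamma ρ * mlRelaxation ρ ρ l t
      + l * ∫ ξ in (0 : ℝ)..t, (t - ξ) ^ (ρ - 1) * mlRelaxation ρ ρ l ξ = t ^ (ρ - 1) := by
  have := Real.Gamma_pos_of_pos hρ
  rw [integral_sub_rpow_mul_mlRelaxation hρ hρ hρ l ht, mlRelaxation_eq_sub hρ hρ l ht]
  field_simp
  ring

theorem intervalIntegrable_mlRelaxation {ρ μ t : ℝ} (hρ : 0 < ρ) (hμ : 0 < μ) (l : ℝ)
    (ht : 0 < t) : IntervalIntegrable (mlRelaxation ρ μ l) volume 0 t := by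
  simpa using intervalIntegrable_sub_rpow_mul_mlRelaxation hρ hμ one_pos l ht

theorem mul_integral_mlRelaxation {ρ t : ℝ} (hρ : 0 < ρ) (l : ℝ) (ht : 0 < t) :
    l * ∫ ξ in (0 : ℝ)..t, mlRelaxation ρ ρ l ξ = 1 - mlRelaxation ρ 1 l t := by
  have h := integral_sub_rpow_mul_mlRelaxation hρ hρ one_pos l ht
  have h2 := mlRelaxation_eq_sub hρ one_pos l ht
  simp only [sub_self, Real.rpow_zero, one_mul, Real.Gamma_one, div_one] at h h2
  rw [h, h2, add_comm (1 : ℝ) ρ]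
  ring

theorem fracIntegral_mlRelaxation {ρ t : ℝ} (hρ : 0 < ρ) (hρ1 : ρ ≤ 1) (l : ℝ) (ht : 0 < t) :
    fracIntegral (1 - ρ) (mlRelaxation ρ ρ l) t = mlRelaxation ρ 1 l t := by
  rcases hρ1.eq_or_lt with rfl | h1
  · simp [fracIntegral]
  · have hb : 0 < 1 - ρ := by linarith
    have := Real.Gamma_pos_of_pos hb
    rw [fracIntegral, if_neg hb.ne']
    simp only [smul_eq_mul]
    rw [integral_sub_rpow_mul_mlRelaxation hρ hρ hb l ht]
    rw [add_sub_cancel]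
    field_simp

/-! ### Positivity and bounds uniform in the eigenvalue -/

/-- The Volterra kernel `t ^ (ρ - 1)` is log-convex, so the solution of the relaxation equation has
no sign change. -/
theorem mlRelaxation_nonneg {ρ l t : ℝ} (hρ : 0 < ρ) (hρ1 : ρ ≤ 1) (hl : 0 ≤ l) (ht : 0 < t) :
    0 ≤ mlRelaxation ρ ρ l t := by
  by_contra! hneg
  -- The factor of e that is continuous up to 0, where it equals 1/Γ(ρ) > 0. Hence the first point
  -- `t0` with g ≤ 0 is positive and e > 0 before it.
  set g : ℝ → ℝ := fun s => mittagLeffler ρ ρ (-l * s ^ ρ) with hg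
  set e : ℝ → ℝ := mlRelaxation ρ ρ l with he
  have heg : ∀ s, e s = s ^ (ρ - 1) * g s := fun s => rfl
  have hgc : ContinuousOn g (Ici 0) :=
    (continuous_mittagLeffler hρ hρ).comp_continuousOn
      (continuousOn_const.mul (continuousOn_id.rpow_const fun x _ => Or.inr hρ.le))
  have hG := Real.Gamma_pos_of_pos hρ
  have hg0 : 0 < g 0 := by
    simp only [hg, Real.zero_rpow hρ.ne', mul_zero, mittagLeffler_zero]
    positivity
  set S : Set ℝ := Ici 0 ∩ g ⁻¹' Iic 0
  have hScl : IsClosed S := hgc.preimage_isClosed_of_isClosed isClosed_Ici isClosed_Iic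
  have hSne : S.Nonempty := ⟨t, ht.le, by
    rw [heg] at hneg
    exact (neg_of_mul_neg_right hneg (Real.rpow_nonneg ht.le _)).le⟩
  have hSbd : BddBelow S := ⟨0, fun x hx => hx.1⟩
  set t0 := sInf S
  have ht0S : t0 ∈ S := hScl.csInf_mem hSne hSbd
  have ht0 : 0 < t0 := by
    rcases eq_or_lt_of_le (show 0 ≤ t0 from ht0S.1) with h | h
    · have := ht0S.2
      rw [← h] at this
      exact absurd hg0 (not_lt.2 this)
    · exact h
  have hpos : ∀ s, 0 < s → s < t0 → 0 < e s := fun s hs hst => by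
    rw [heg]
    refine mul_pos (Real.rpow_pos_of_pos hs _) ?_
    by_contra! h
    exact absurd (csInf_le hSbd (⟨hs.le, h⟩ : s ∈ S)) (not_le.2 hst)
  have het0 : e t0 ≤ 0 := by
    rw [heg]
    exact mul_nonpos_of_nonneg_of_nonpos (Real.rpow_nonneg ht0.le _) ht0S.2
  -- The bound Γ(ρ)/2 leaves room for the factor 2 lost in `hratio`; δ ≤ t0/2 keeps `t1` at or above
  -- t0/2.
  obtain ⟨δ, hδ0, hδt, hδ⟩ : ∃ δ, 0 < δ ∧ δ ≤ t0 / 2 ∧ l * (δ ^ ρ / ρ) < Real.Gamma ρ / 2 := by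
    have hlim : Tendsto (fun δ : ℝ => l * (δ ^ ρ / ρ)) (𝓝[>] 0) (𝓝 0) := by
      have : Tendsto (fun δ : ℝ => l * (δ ^ ρ / ρ)) (𝓝[>] 0) (𝓝 (l * ((0 : ℝ) ^ ρ / ρ))) :=
        tendsto_nhdsWithin_of_tendsto_nhds
          (((Real.continuous_rpow_const hρ.le).div_const ρ).const_mul l).continuousAt
      simpa [Real.zero_rpow hρ.ne'] using this
    have h1 := hlim.eventually (gt_mem_nhds (show 0 < Real.Gamma ρ / 2 by positivity))
    have h2 : ∀ᶠ δ in 𝓝[>] (0 : ℝ), δ ∈ Ioc 0 (t0 / 2) := Ioc_mem_nhdsGT (by positivity)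
    obtain ⟨δ, h3, h4⟩ := (h1.and h2).exists
    exact ⟨δ, h4.1, h4.2, h3⟩
  have hec : ContinuousOn e (Icc (t0 - δ) t0) :=
    (continuousOn_mlRelaxation hρ hρ l).mono fun x hx => by
      have := hx.1
      simp only [mem_Ioi]
      linarith
  -- The Volterra equations at `t0` and `t1` are compared. Maximality lets e(t1) bound e on the
  -- remaining interval [t1, t0].
  obtain ⟨t1, ht1, hmax⟩ := isCompact_Icc.exists_isMaxOn
    (nonempty_Icc.2 (by linarith : t0 - δ ≤ t0)) hec
  have ht1e : 0 < e t1 := lt_of_lt_of_le (hpos (t0 - δ) (by linarith) (by linarith))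
    (hmax (left_mem_Icc.2 (by linarith)))
  have ht1pos : 0 < t1 := by linarith [ht1.1]
  have ht1lt : t1 < t0 := by
    refine lt_of_le_of_ne ht1.2 fun h => ?_
    rw [h] at ht1e
    linarith
  have hI0 := intervalIntegrable_sub_rpow_mul_mlRelaxation hρ hρ hρ l ht0
  have hI1 := intervalIntegrable_sub_rpow_mul_mlRelaxation hρ hρ hρ l ht1pos
  have hIa : IntervalIntegrable (fun ξ => (t0 - ξ) ^ (ρ - 1) * e ξ) volume 0 t1 :=
    hI0.mono_set (by rw [uIcc_of_le ht1pos.le, uIcc_of_le ht0.le]; exact Icc_subset_Icc_right ht1.2)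
  have hIb : IntervalIntegrable (fun ξ => (t0 - ξ) ^ (ρ - 1) * e ξ) volume t1 t0 :=
    hI0.mono_set (by rw [uIcc_of_le ht1.2, uIcc_of_le ht0.le]; exact Icc_subset_Icc_left ht1pos.le)
  have hV0 := Gamma_mul_mlRelaxation_add hρ l ht0
  have hV1 := Gamma_mul_mlRelaxation_add hρ l ht1pos
  rw [← intervalIntegral.integral_add_adjacent_intervals hIa hIb] at hV0
  have hk0 : 0 < t0 ^ (ρ - 1) := Real.rpow_pos_of_pos ht0 _
  have hk1 : 0 < t1 ^ (ρ - 1) := Real.rpow_pos_of_pos ht1pos _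
  -- The log-convexity step: t1 (t0 - ξ) ≥ t0 (t1 - ξ) because ξ (t0 - t1) ≥ 0, and ρ - 1 ≤ 0
  -- reverses the inequality.
  have hA : t1 ^ (ρ - 1) * ∫ ξ in (0 : ℝ)..t1, (t0 - ξ) ^ (ρ - 1) * e ξ
      ≤ t0 ^ (ρ - 1) * ∫ ξ in (0 : ℝ)..t1, (t1 - ξ) ^ (ρ - 1) * e ξ := by
    rw [← intervalIntegral.integral_const_mul, ← intervalIntegral.integral_const_mul]
    refine intervalIntegral.integral_mono_on_of_le_Ioo ht1pos.le (hIa.const_mul _)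
      (hI1.const_mul _) fun ξ hξ => ?_
    have hξ0 := hpos ξ hξ.1 (hξ.2.trans ht1lt)
    rw [← mul_assoc, ← mul_assoc]
    refine mul_le_mul_of_nonneg_right ?_ hξ0.le
    have h1 : 0 < t1 - ξ := sub_pos.2 hξ.2
    have h2 : 0 < t0 - ξ := by linarith
    rw [← Real.mul_rpow ht1pos.le h2.le, ← Real.mul_rpow ht0.le h1.le]
    refine Real.rpow_le_rpow_of_nonpos (by positivity) ?_ (by linarith)
    nlinarith [hξ.1]
  have hB : ∫ ξ in t1..t0, (t0 - ξ) ^ (ρ - 1) * e ξ ≤ e t1 * (δ ^ ρ / ρ) := by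
    have hIc : IntervalIntegrable (fun ξ => (t0 - ξ) ^ (ρ - 1)) volume t1 t0 := by
      have := (intervalIntegral.intervalIntegrable_rpow' (a := 0) (b := t0 - t1)
        (show -1 < ρ - 1 by linarith)).comp_sub_left t0
      simpa using this.symm
    calc ∫ ξ in t1..t0, (t0 - ξ) ^ (ρ - 1) * e ξ
        ≤ ∫ ξ in t1..t0, (t0 - ξ) ^ (ρ - 1) * e t1 := by
          refine intervalIntegral.integral_mono_on ht1.2 hIb (hIc.mul_const _) fun ξ hξ => ?_
          refine mul_le_mul_of_nonneg_left (hmax ⟨ht1.1.trans hξ.1, hξ.2⟩)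
            (Real.rpow_nonneg (sub_nonneg.2 hξ.2) _)
      _ = e t1 * ((t0 - t1) ^ ρ / ρ) := by
          rw [intervalIntegral.integral_mul_const,
            intervalIntegral.integral_comp_sub_left (fun x => x ^ (ρ - 1)) t0, sub_self,
            integral_rpow (Or.inl (by linarith)), sub_add_cancel, Real.zero_rpow hρ.ne']
          ring
      _ ≤ e t1 * (δ ^ ρ / ρ) := by
          have : t0 - t1 ≤ δ := by linarith [ht1.1]
          have h0 : 0 ≤ t0 - t1 := by linarith
          gcongr
  have hratio : t1 ^ (ρ - 1) ≤ 2 * t0 ^ (ρ - 1) := by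
    have h1 : t1 ^ (ρ - 1) ≤ (t0 / 2) ^ (ρ - 1) :=
      Real.rpow_le_rpow_of_nonpos (by positivity) (by linarith [ht1.1]) (by linarith)
    have h2 : (1 / 2 : ℝ) ^ (ρ - 1) ≤ (1 / 2 : ℝ) ^ (-1 : ℝ) :=
      Real.rpow_le_rpow_of_exponent_ge (by norm_num) (by norm_num) (by linarith)
    rw [Real.rpow_neg_one] at h2
    rw [show t0 / 2 = (1 / 2) * t0 by ring, Real.mul_rpow (by norm_num) ht0.le] at h1
    nlinarith
  rw [← he] at hV0 hV1
  set X := ∫ ξ in (0 : ℝ)..t1, (t0 - ξ) ^ (ρ - 1) * e ξ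
  set Y := ∫ ξ in t1..t0, (t0 - ξ) ^ (ρ - 1) * e ξ
  set Z := ∫ ξ in (0 : ℝ)..t1, (t1 - ξ) ^ (ρ - 1) * e ξ
  have h1 : t0 ^ (ρ - 1) ≤ l * (X + Y) := by nlinarith
  have h2 : t1 ^ (ρ - 1) * (l * X) ≤ t0 ^ (ρ - 1) * (t1 ^ (ρ - 1) - Real.Gamma ρ * e t1) := by
    rw [← eq_sub_iff_add_eq'.2 hV1]
    linarith [mul_le_mul_of_nonneg_left hA hl]
  -- The terms t0^(ρ-1) t1^(ρ-1) cancel, so e(t1) is controlled by `Y` alone, which the choice of δ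
  -- makes too small.
  have h3 : t0 ^ (ρ - 1) * (Real.Gamma ρ * e t1) ≤ t1 ^ (ρ - 1) * (l * Y) := by
    nlinarith [mul_le_mul_of_nonneg_left h1 hk1.le]
  have h4 : l * Y < Real.Gamma ρ / 2 * e t1 := by
    calc l * Y ≤ l * (e t1 * (δ ^ ρ / ρ)) := by gcongr
      _ = l * (δ ^ ρ / ρ) * e t1 := by ring
      _ < _ := by gcongr
  have h5 : t1 ^ (ρ - 1) * (l * Y) < 2 * t0 ^ (ρ - 1) * (Real.Gamma ρ / 2 * e t1) := by
    calc t1 ^ (ρ - 1) * (l * Y) < t1 ^ (ρ - 1) * (Real.Gamma ρ / 2 * e t1) := by gcongr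
      _ ≤ _ := by gcongr
  linarith

theorem integral_Ioc_nonneg {f : ℝ → ℝ} {a b : ℝ} (hab : a ≤ b) (hf : ∀ x ∈ Ioc a b, 0 ≤ f x) :
    0 ≤ ∫ x in a..b, f x := by
  rw [intervalIntegral.integral_of_le hab]
  exact setIntegral_nonneg measurableSet_Ioc hf

theorem mlRelaxation_le {ρ l t : ℝ} (hρ : 0 < ρ) (hρ1 : ρ ≤ 1) (hl : 0 ≤ l) (ht : 0 < t) :
    mlRelaxation ρ ρ l t ≤ t ^ (ρ - 1) / Real.Gamma ρ := by
  have hG := Real.Gamma_pos_of_pos hρ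
  rw [le_div_iff₀ hG, ← Gamma_mul_mlRelaxation_add hρ l ht, mul_comm]
  refine le_add_of_nonneg_right (mul_nonneg hl ?_)
  refine integral_Ioc_nonneg ht.le fun ξ hξ => ?_
  exact mul_nonneg (Real.rpow_nonneg (sub_nonneg.2 hξ.2) _)
    (mlRelaxation_nonneg hρ hρ1 hl hξ.1)

theorem mlRelaxation_one_le {ρ l t : ℝ} (hρ : 0 < ρ) (hρ1 : ρ ≤ 1) (hl : 0 ≤ l) (ht : 0 < t) :
    mlRelaxation ρ 1 l t ≤ 1 := by
  have h := mul_integral_mlRelaxation hρ l ht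
  have h2 : 0 ≤ ∫ ξ in (0 : ℝ)..t, mlRelaxation ρ ρ l ξ :=
    integral_Ioc_nonneg ht.le fun ξ hξ =>
      mlRelaxation_nonneg hρ hρ1 hl hξ.1
  nlinarith [mul_nonneg hl h2]

/-- This function is the fractional integral of order 1 - ρ of the nonnegative e. -/
theorem mlRelaxation_one_nonneg {ρ l t : ℝ} (hρ : 0 < ρ) (hρ1 : ρ ≤ 1) (hl : 0 ≤ l) (ht : 0 < t) :
    0 ≤ mlRelaxation ρ 1 l t := by
  rw [← fracIntegral_mlRelaxation hρ hρ1 l ht, fracIntegral]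
  split_ifs with h
  · exact mlRelaxation_nonneg hρ hρ1 hl ht
  · have hb : 0 < 1 - ρ := lt_of_le_of_ne (by linarith) (Ne.symm h)
    refine smul_nonneg (inv_nonneg.2 (Real.Gamma_pos_of_pos hb).le) ?_
    refine integral_Ioc_nonneg ht.le fun ξ hξ => ?_
    exact mul_nonneg (Real.rpow_nonneg (sub_nonneg.2 hξ.2) _)
      (mlRelaxation_nonneg hρ hρ1 hl hξ.1)

/-! ### The bound λ e(t) ≤ 1/t by a convolution identity -/

theorem tsum_antidiagonal_add (g : ℕ → ℝ) (n : ℕ) :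
    ∑' c : Finset.HasAntidiagonal.antidiagonal n, g (c.1.1 + c.1.2) = ((n : ℝ) + 1) * g n := by
  rw [tsum_fintype, Finset.sum_coe_sort (Finset.HasAntidiagonal.antidiagonal n) fun p => g (p.1 + p.2),
    Finset.sum_congr rfl fun p hp => by rw [Finset.HasAntidiagonal.mem_antidiagonal.1 hp], Finset.sum_const,
    Finset.Nat.card_antidiagonal, nsmul_eq_mul]
  push_cast
  ring

theorem tsum_tsum_add {f : ℕ → ℝ} (hf : Summable fun n : ℕ => ((n : ℝ) + 1) * |f n|) :
    ∑' i, ∑' j, f (i + j) = ∑' n : ℕ, ((n : ℝ) + 1) * f n := by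
  have hs : Summable fun x : Σ n : ℕ, Finset.HasAntidiagonal.antidiagonal n => f (x.2.1.1 + x.2.1.2) := by
    refine Summable.of_abs ?_
    rw [summable_sigma_of_nonneg fun _ => abs_nonneg _]
    refine ⟨fun n => (hasSum_fintype _).summable, ?_⟩
    simpa only [tsum_antidiagonal_add fun m => |f m|] using hf
  have hp : Summable fun p : ℕ × ℕ => f (p.1 + p.2) :=
    (Finset.HasAntidiagonal.sigmaAntidiagonalEquivProd (A := ℕ)).summable_iff.1 hs
  rw [← hp.tsum_prod, ← (Finset.HasAntidiagonal.sigmaAntidiagonalEquivProd (A := ℕ)).tsum_eq]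
  refine (Summable.tsum_sigma hs).trans (tsum_congr fun n => ?_)
  exact tsum_antidiagonal_add f n

/-- In Laplace transforms, e becomes 1/(p^ρ + l) and E_{ρ,1}(-l t^ρ) becomes p^(ρ-1)/(p^ρ + l);
multiplication by t is -d/dp, which gives ρ times their product. The proof is the Cauchy-product
version of this. -/
theorem mul_mlRelaxation_eq_integral {ρ l t : ℝ} (hρ : 0 < ρ) (hρ1 : ρ ≤ 1) (hl : 0 ≤ l)
    (ht : 0 < t) :
    t * mlRelaxation ρ ρ l t
      = ρ * ∫ ξ in Ioc 0 t, mittagLeffler ρ 1 (-l * (t - ξ) ^ ρ) * mlRelaxation ρ ρ l ξ := by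
  have hG : ∀ (n : ℕ) {ν : ℝ}, 0 < ν → 0 < Real.Gamma (ρ * n + ν) := fun n ν hν =>
    Real.Gamma_pos_of_pos (by positivity)
  set e : ℝ → ℝ := mlRelaxation ρ ρ l with he
  set F : ℕ → ℝ → ℝ := fun n ξ =>
    (-l) ^ n / Real.Gamma (ρ * n + 1) * ((t - ξ) ^ (ρ * n + 1 - 1) * e ξ) with hF
  have hI : ∀ n : ℕ, Integrable (fun ξ => (t - ξ) ^ (ρ * n + 1 - 1) * e ξ)
      (volume.restrict (Ioc 0 t)) := fun n =>
    (intervalIntegrable_iff_integrableOn_Ioc_of_le ht.le).1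
      (intervalIntegrable_sub_rpow_mul_mlRelaxation (b := ρ * n + 1) hρ hρ (by positivity) l ht)
  have hFint : ∀ n, Integrable (F n) (volume.restrict (Ioc 0 t)) := fun n => (hI n).const_mul _
  have heI : IntegrableOn e (Ioc 0 t) :=
    (intervalIntegrable_iff_integrableOn_Ioc_of_le ht.le).1
      (intervalIntegrable_mlRelaxation hρ hρ l ht)
  have hsum : Summable fun n => ∫ ξ in Ioc 0 t, ‖F n ξ‖ := by
    refine Summable.of_nonneg_of_le (fun n => integral_nonneg fun _ => norm_nonneg _) (fun n => ?_)
      ((summable_abs_pow_div_Gamma hρ one_pos (l * t ^ ρ)).mul_right (∫ ξ in Ioc 0 t, e ξ))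
    rw [← integral_const_mul]
    refine setIntegral_mono_on (hFint n).norm (heI.const_mul _) measurableSet_Ioc fun ξ hξ => ?_
    have h1 := mlRelaxation_nonneg hρ hρ1 hl hξ.1
    have h2 : 0 ≤ t - ξ := sub_nonneg.2 hξ.2
    have h3 : (t - ξ) ^ (ρ * n + 1 - 1) ≤ (t ^ ρ) ^ n := by
      rw [← Real.rpow_natCast, ← Real.rpow_mul ht.le, add_sub_cancel_right]
      exact Real.rpow_le_rpow h2 (by linarith [hξ.1]) (by positivity)
    have := hG n one_pos
    simp only [hF, norm_mul, norm_div, norm_pow, norm_neg, Real.norm_eq_abs]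
    rw [abs_of_pos (hG n one_pos), abs_of_nonneg (Real.rpow_nonneg h2 _), abs_of_nonneg hl,
      abs_of_nonneg (by positivity : 0 ≤ l * t ^ ρ), abs_of_nonneg h1, mul_pow, ← mul_assoc,
      mul_div_right_comm]
    gcongr
  have key := hasSum_integral_of_summable_integral_norm hFint hsum
  have h5 : ∫ ξ in Ioc 0 t, mittagLeffler ρ 1 (-l * (t - ξ) ^ ρ) * e ξ
      = ∫ ξ in Ioc 0 t, ∑' n, F n ξ := by
    refine setIntegral_congr_fun measurableSet_Ioc fun ξ hξ => ?_
    have h6 := (hasSum_mittagLeffler hρ one_pos (-l * (t - ξ) ^ ρ)).mul_right (e ξ)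
    rw [← h6.tsum_eq]
    congr 1
    ext n
    simp only [hF]
    rw [mul_pow, ← Real.rpow_natCast ((t - ξ) ^ ρ), ← Real.rpow_mul (sub_nonneg.2 hξ.2),
      add_sub_cancel_right]
    ring
  set f : ℕ → ℝ := fun n => (-l) ^ n * t ^ (ρ * n + ρ) / Real.Gamma (ρ * n + (ρ + 1)) with hf
  have hFf : ∀ i, ∫ ξ in Ioc 0 t, F i ξ = ∑' j, f (i + j) := by
    intro i
    have h7 := integral_sub_rpow_mul_mlRelaxation (b := ρ * i + 1) hρ hρ (by positivity) l ht
    rw [intervalIntegral.integral_of_le ht.le] at h7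
    simp only [hF]
    rw [integral_const_mul, h7, ← mul_assoc, div_mul_cancel₀ _ (hG i one_pos).ne']
    have h8 := (hasSum_mlRelaxation hρ (show 0 < ρ + (ρ * i + 1) by positivity) l ht).mul_left
      ((-l) ^ i)
    rw [← h8.tsum_eq]
    refine tsum_congr fun j => ?_
    simp only [hf]
    rw [show ρ * ((i + j : ℕ) : ℝ) + ρ = ρ * j + (ρ + (ρ * i + 1)) - 1 by push_cast; ring,
      show ρ * ((i + j : ℕ) : ℝ) + (ρ + 1) = ρ * j + (ρ + (ρ * i + 1)) by push_cast; ring, pow_add]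
    ring
  have hfs : Summable fun n : ℕ => ((n : ℝ) + 1) * |f n| := by
    refine ((summable_mul_pow_div_Gamma hρ (show 0 < ρ + 1 by positivity)
      (-l * t ^ ρ)).mul_left (t ^ ρ)).congr fun n => ?_
    simp only [hf]
    rw [abs_div, abs_of_pos (hG n (show 0 < ρ + 1 by positivity)), ← abs_pow, mul_pow,
      ← Real.rpow_natCast (t ^ ρ), ← Real.rpow_mul ht.le, Real.rpow_add ht, abs_mul, abs_mul,
      abs_mul, abs_of_pos (Real.rpow_pos_of_pos ht ρ)]
    ring
  rw [h5, ← key.tsum_eq, tsum_congr hFf, tsum_tsum_add hfs, ← tsum_mul_left,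
    ← ((hasSum_mlRelaxation hρ hρ l ht).mul_left t).tsum_eq]
  refine tsum_congr fun n => ?_
  have h9 := hG n hρ
  simp only [hf]
  -- Γ(ρn + ρ + 1) = ρ(n + 1) Γ(ρn + ρ): the factor n + 1 counting the pairs i + j = n cancels along
  -- with ρ.
  rw [← add_assoc, Real.Gamma_add_one (by positivity), Real.rpow_sub_one ht.ne']
  field_simp

/-- Bounding the first factor of the convolution by 1 gives l t e(t) ≤ ρ l ∫ e = ρ (1 - E_{ρ,1}(-l
t^ρ)) ≤ 1. -/
theorem mul_mul_mlRelaxation_le {ρ l t : ℝ} (hρ : 0 < ρ) (hρ1 : ρ ≤ 1) (hl : 0 ≤ l)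
    (ht : 0 < t) : l * mlRelaxation ρ ρ l t ≤ 1 / t := by
  have heI : IntegrableOn (mlRelaxation ρ ρ l) (Ioc 0 t) :=
    (intervalIntegrable_iff_integrableOn_Ioc_of_le ht.le).1
      (intervalIntegrable_mlRelaxation hρ hρ l ht)
  have h1 : ∫ ξ in Ioc 0 t, mittagLeffler ρ 1 (-l * (t - ξ) ^ ρ) * mlRelaxation ρ ρ l ξ
      ≤ ∫ ξ in Ioc 0 t, mlRelaxation ρ ρ l ξ := by
    refine integral_mono_of_nonneg ?_ heI ?_
    all_goals
      rw [← restrict_Ioo_eq_restrict_Ioc]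
      filter_upwards [ae_restrict_mem measurableSet_Ioo] with ξ hξ
      have h2 := mlRelaxation_nonneg hρ hρ1 hl hξ.1
      have h3 := mlRelaxation_one_nonneg hρ hρ1 hl (sub_pos.2 hξ.2)
      have h4 := mlRelaxation_one_le hρ hρ1 hl (sub_pos.2 hξ.2)
      rw [mlRelaxation_one] at h3 h4
    · exact mul_nonneg h3 h2
    · exact mul_le_of_le_one_left h2 h4
  have h5 := mul_integral_mlRelaxation hρ l ht
  rw [intervalIntegral.integral_of_le ht.le] at h5
  have h6 := mlRelaxation_one_nonneg hρ hρ1 hl ht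
  rw [le_div_iff₀ ht, mul_assoc, mul_comm _ t, mul_mlRelaxation_eq_integral hρ hρ1 hl ht]
  nlinarith [mul_le_mul_of_nonneg_left h1 hl]

/-! ### Fractional integrals under bounded linear maps -/

theorem ContinuousLinearMap.map_fracIntegral {E F : Type*} [NormedAddCommGroup E]
    [NormedSpace ℝ E] [CompleteSpace E] [NormedAddCommGroup F] [NormedSpace ℝ F] [CompleteSpace F]
    (L : E →L[ℝ] F) {σ t : ℝ} {u : ℝ → E} (hu : FracIntegrableAt σ u t) :
    L (fracIntegral σ u t) = fracIntegral σ (fun s => L (u s)) t := by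
  unfold fracIntegral
  split_ifs with h
  · rfl
  · rw [map_smul, ← L.intervalIntegral_comp_comm (hu h)]
    simp only [map_smul]

theorem FracIntegrableAt.clm_comp {E F : Type*} [NormedAddCommGroup E]
    [NormedSpace ℝ E] [NormedAddCommGroup F] [NormedSpace ℝ F]
    (L : E →L[ℝ] F) {σ t : ℝ} {u : ℝ → E} (hu : FracIntegrableAt σ u t) :
    FracIntegrableAt σ (fun s => L (u s)) t := by
  intro h
  have h1 := hu h
  refine (show IntervalIntegrable (fun ξ => L ((t - ξ) ^ (σ - 1) • u ξ)) volume 0 t from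
    ⟨L.integrable_comp h1.1, L.integrable_comp h1.2⟩).congr fun ξ _ => ?_
  simp

/-! ### Uniqueness for the scalar equation -/

section Volterra

variable {E : Type*} [NormedAddCommGroup E]

/-- A Gronwall lemma for a singular kernel, by the weighted supremum of e^(-ωt) ‖G t‖: the weighted
kernel has mass at most Γ(ρ) ω^(-ρ), so large ω makes the inequality a strict contraction. -/
theorem eqOn_zero_of_norm_le_integral {ρ c T : ℝ} (hρ : 0 < ρ) (hc : 0 ≤ c) (hT : 0 < T)
    {G : ℝ → E} (hG : ContinuousOn G (Icc 0 T)) (hG0 : G 0 = 0)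
    (h : ∀ t ∈ Ioc 0 T, ‖G t‖ ≤ c * ∫ s in (0 : ℝ)..t, (t - s) ^ (ρ - 1) * ‖G s‖) :
    ∀ t ∈ Icc 0 T, G t = 0 := by
  have hΓ := Real.Gamma_pos_of_pos hρ
  obtain ⟨ω, hω0, hω⟩ : ∃ ω : ℝ, 0 < ω ∧ c * ((1 / ω) ^ ρ * Real.Gamma ρ) < 1 := by
    have hlim : Tendsto (fun ω : ℝ => c * ((1 / ω) ^ ρ * Real.Gamma ρ)) atTop (𝓝 0) := by
      have h1 : Tendsto (fun ω : ℝ => 1 / ω) atTop (𝓝 0) := by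
        simpa using tendsto_inv_atTop_zero (𝕜 := ℝ)
      have h2 := ((((Real.continuous_rpow_const hρ.le).tendsto 0).comp h1).mul_const
        (Real.Gamma ρ)).const_mul c
      simpa [Real.zero_rpow hρ.ne', Function.comp_def] using h2
    obtain ⟨ω, h1, h2⟩ := ((hlim.eventually (gt_mem_nhds one_pos)).and (eventually_gt_atTop 0)).exists
    exact ⟨ω, h2, h1⟩
  have hcont : ContinuousOn (fun t => Real.exp (-(ω * t)) * ‖G t‖) (Icc 0 T) :=
    ContinuousOn.mul (by fun_prop) hG.norm
  obtain ⟨t, ht, hmax⟩ := isCompact_Icc.exists_isMaxOn (nonempty_Icc.2 hT.le) hcont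
  set M := Real.exp (-(ω * t)) * ‖G t‖ with hM
  have hMnn : 0 ≤ M := by positivity
  have hle : ∀ s ∈ Icc 0 T, ‖G s‖ ≤ M * Real.exp (ω * s) := fun s hs => by
    have h1 : Real.exp (-(ω * s)) * ‖G s‖ ≤ M := hmax hs
    rw [Real.exp_neg, inv_mul_le_iff₀ (Real.exp_pos _)] at h1
    linarith
  suffices hM0 : M = 0 by
    intro s hs
    have := hle s hs
    rw [hM0, zero_mul] at this
    exact norm_le_zero_iff.1 this
  rcases ht.1.eq_or_lt with h0 | h0
  · rw [hM, ← h0, hG0, norm_zero, mul_zero]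
  have hI : IntegrableOn (fun s => s ^ (ρ - 1) * Real.exp (-(ω * s))) (Ioi 0) := by
    refine Integrable.of_integral_ne_zero ?_
    rw [Real.integral_rpow_mul_exp_neg_mul_Ioi hρ hω0]
    positivity
  have hIt : IntervalIntegrable (fun s => s ^ (ρ - 1) * Real.exp (-(ω * s))) volume 0 t :=
    (intervalIntegrable_iff_integrableOn_Ioc_of_le h0.le).2 (hI.mono_set Ioc_subset_Ioi_self)
  have hkey : ∫ s in (0 : ℝ)..t, (t - s) ^ (ρ - 1) * ‖G s‖
      ≤ M * Real.exp (ω * t) * ((1 / ω) ^ ρ * Real.Gamma ρ) := by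
    have hJ : IntervalIntegrable
        (fun s => (t - s) ^ (ρ - 1) * Real.exp (-(ω * (t - s)))) volume 0 t := by
      simpa using (hIt.comp_sub_left t).symm
    have hsub : Icc 0 t ⊆ Icc 0 T := Icc_subset_Icc_right ht.2
    have hK : IntervalIntegrable (fun s => (t - s) ^ (ρ - 1)) volume 0 t := by
      simpa using ((intervalIntegral.intervalIntegrable_rpow' (a := 0) (b := t)
        (show -1 < ρ - 1 by linarith)).comp_sub_left t).symm
    calc ∫ s in (0 : ℝ)..t, (t - s) ^ (ρ - 1) * ‖G s‖
        ≤ ∫ s in (0 : ℝ)..t, M * Real.exp (ω * t) *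
            ((t - s) ^ (ρ - 1) * Real.exp (-(ω * (t - s)))) := by
          refine intervalIntegral.integral_mono_on h0.le
            (hK.mul_continuousOn ?_) (hJ.const_mul _) fun s hs => ?_
          · rw [uIcc_of_le h0.le]
            exact (hG.mono hsub).norm
          · have h1 : Real.exp (ω * s) = Real.exp (ω * t) * Real.exp (-(ω * (t - s))) := by
              rw [← Real.exp_add]; ring_nf
            have h2 := hle s (hsub hs)
            rw [h1] at h2
            calc (t - s) ^ (ρ - 1) * ‖G s‖
                ≤ (t - s) ^ (ρ - 1) * (M * (Real.exp (ω * t) * Real.exp (-(ω * (t - s))))) :=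
                  mul_le_mul_of_nonneg_left h2 (Real.rpow_nonneg (sub_nonneg.2 hs.2) _)
              _ = _ := by ring
      _ = M * Real.exp (ω * t) * ∫ s in (0 : ℝ)..t, s ^ (ρ - 1) * Real.exp (-(ω * s)) := by
          rw [intervalIntegral.integral_const_mul, intervalIntegral.integral_comp_sub_left
            (fun s => s ^ (ρ - 1) * Real.exp (-(ω * s))) t]
          simp
      _ ≤ _ := by
          rw [← Real.integral_rpow_mul_exp_neg_mul_Ioi hρ hω0,
            intervalIntegral.integral_of_le h0.le]
          refine mul_le_mul_of_nonneg_left (setIntegral_mono_set hI ?_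
            Ioc_subset_Ioi_self.eventuallyLE) (by positivity)
          filter_upwards [ae_restrict_mem measurableSet_Ioi] with y hy
          have : (0 : ℝ) < y := hy
          positivity
  have h3 := (h t ⟨h0, ht.2⟩).trans (mul_le_mul_of_nonneg_left hkey hc)
  have h4 : M ≤ M * (c * ((1 / ω) ^ ρ * Real.Gamma ρ)) := by
    have h5 : Real.exp (-(ω * t)) * Real.exp (ω * t) = 1 := by
      rw [← Real.exp_add]; simp
    calc M ≤ Real.exp (-(ω * t)) *
          (c * (M * Real.exp (ω * t) * ((1 / ω) ^ ρ * Real.Gamma ρ))) :=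
          mul_le_mul_of_nonneg_left h3 (Real.exp_pos _).le
      _ = (Real.exp (-(ω * t)) * Real.exp (ω * t)) *
          (M * (c * ((1 / ω) ^ ρ * Real.Gamma ρ))) := by ring
      _ = _ := by rw [h5, one_mul]
  nlinarith

variable [NormedSpace ℝ E]

theorem integral_sub_rpow_mul_sub_rpow_neg {ρ ξ t : ℝ} (hρ : 0 < ρ) (hρ1 : ρ < 1) (h : ξ < t) :
    ∫ s in ξ..t, (t - s) ^ (ρ - 1) * (s - ξ) ^ (-ρ) = Real.Gamma ρ * Real.Gamma (1 - ρ) := by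
  have h1 := integral_sub_rpow_mul_rpow hρ (sub_pos.2 hρ1) (sub_pos.2 h)
  have h2 := intervalIntegral.integral_comp_sub_right
    (fun s => (t - ξ - s) ^ (ρ - 1) * s ^ (-ρ)) (a := ξ) (b := t) ξ
  simp only [sub_self, sub_sub_sub_cancel_right] at h2
  rw [h2]
  simpa [add_sub_cancel] using h1

theorem intervalIntegrable_sub_rpow_mul_sub_rpow_neg {ρ ξ t : ℝ} (hρ : 0 < ρ) (hρ1 : ρ < 1)
    (h : ξ < t) :
    IntervalIntegrable (fun s => (t - s) ^ (ρ - 1) * (s - ξ) ^ (-ρ)) volume ξ t := by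
  have h1 := (intervalIntegrable_sub_rpow_mul_rpow hρ (sub_pos.2 hρ1) (sub_pos.2 h)).comp_sub_right ξ
  simpa using h1

/-- The fractional integrals of orders `ρ` and `1 - ρ` compose to the ordinary integral. -/
theorem integral_sub_rpow_smul_integral [CompleteSpace E] {ρ t : ℝ} (hρ : 0 < ρ) (hρ1 : ρ < 1) (ht : 0 < t)
    {z : ℝ → E} (hz : IntegrableOn z (Ioc 0 t)) :
    ∫ s in (0 : ℝ)..t, (t - s) ^ (ρ - 1) • ∫ ξ in (0 : ℝ)..s, (s - ξ) ^ (-ρ) • z ξ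
      = (Real.Gamma ρ * Real.Gamma (1 - ρ)) • ∫ ξ in (0 : ℝ)..t, z ξ := by
  set C := Real.Gamma ρ * Real.Gamma (1 - ρ)
  -- Extending the kernel by 0 off ξ < s puts Fubini on the square. Its s-integral is the Beta value
  -- `C`, independent of ξ.
  set K : ℝ → ℝ → ℝ := fun s ξ => if ξ < s then (t - s) ^ (ρ - 1) * (s - ξ) ^ (-ρ) else 0 with hK
  have hKm : Measurable (fun p : ℝ × ℝ => K p.1 p.2) := by
    refine Measurable.ite (measurableSet_lt measurable_snd measurable_fst) ?_ measurable_const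
    fun_prop
  have hKind : ∀ ξ, (fun s => K s ξ)
      = (Ioi ξ).indicator fun s => (t - s) ^ (ρ - 1) * (s - ξ) ^ (-ρ) := fun ξ => by
    ext s
    simp only [hK, indicator, mem_Ioi]
  have hIoc : ∀ ξ ∈ Ioo 0 t, Ioi ξ ∩ Ioc 0 t = Ioc ξ t := fun ξ hξ => by
    ext s
    simp only [mem_inter_iff, mem_Ioi, mem_Ioc]
    exact ⟨fun h => ⟨h.1, h.2.2⟩, fun h => ⟨h.1, hξ.1.trans h.1, h.2⟩⟩
  have hKI : ∀ ξ ∈ Ioo 0 t, Integrable (fun s => K s ξ) (volume.restrict (Ioc 0 t)) := by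
    intro ξ hξ
    rw [hKind, integrable_indicator_iff measurableSet_Ioi, IntegrableOn,
      Measure.restrict_restrict measurableSet_Ioi, hIoc ξ hξ]
    exact (intervalIntegrable_iff_integrableOn_Ioc_of_le hξ.2.le).1
      (intervalIntegrable_sub_rpow_mul_sub_rpow_neg hρ hρ1 hξ.2)
  have hKv : ∀ ξ ∈ Ioo 0 t, ∫ s in Ioc 0 t, K s ξ = C := by
    intro ξ hξ
    rw [hKind, integral_indicator measurableSet_Ioi,
      Measure.restrict_restrict measurableSet_Ioi, hIoc ξ hξ,
      ← intervalIntegral.integral_of_le hξ.2.le, integral_sub_rpow_mul_sub_rpow_neg hρ hρ1 hξ.2]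
  have hKnn : ∀ ξ, ∀ s ∈ Ioc 0 t, 0 ≤ K s ξ := by
    intro ξ s hs
    simp only [hK]
    split_ifs with h
    · exact mul_nonneg (Real.rpow_nonneg (sub_nonneg.2 hs.2) _)
        (Real.rpow_nonneg (sub_pos.2 h).le _)
    · exact le_rfl
  -- The endpoint ξ = t must be dropped: there the s-integral of `K` is 0, not `C`.
  have hae : ∀ᵐ ξ ∂volume.restrict (Ioc 0 t), ξ ∈ Ioo 0 t := by
    rw [← restrict_Ioo_eq_restrict_Ioc]
    exact ae_restrict_mem measurableSet_Ioo
  have hint : Integrable (Function.uncurry fun s ξ => K s ξ • z ξ)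
      ((volume.restrict (Ioc 0 t)).prod (volume.restrict (Ioc 0 t))) := by
    have hm : AEStronglyMeasurable (Function.uncurry fun s ξ => K s ξ • z ξ)
        ((volume.restrict (Ioc 0 t)).prod (volume.restrict (Ioc 0 t))) :=
      hKm.aestronglyMeasurable.smul hz.aestronglyMeasurable.comp_snd
    rw [integrable_prod_iff' hm]
    refine ⟨hae.mono fun ξ hξ => (hKI ξ hξ).smul_const (z ξ), ?_⟩
    refine (hz.norm.const_mul C).congr (hae.mono fun ξ hξ => ?_)
    simp only [Function.uncurry_apply_pair, norm_smul]
    rw [integral_mul_const, ← hKv ξ hξ]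
    congr 1
    exact setIntegral_congr_fun measurableSet_Ioc fun s hs =>
      (Real.norm_of_nonneg (hKnn ξ s hs)).symm
  have hswap := integral_integral_swap hint
  have hL : ∫ s in (0 : ℝ)..t, (t - s) ^ (ρ - 1) • ∫ ξ in (0 : ℝ)..s, (s - ξ) ^ (-ρ) • z ξ
      = ∫ s in Ioc 0 t, ∫ ξ in Ioc 0 t, K s ξ • z ξ := by
    rw [intervalIntegral.integral_of_le ht.le]
    refine setIntegral_congr_fun measurableSet_Ioc fun s hs => ?_
    have h1 : (fun ξ => K s ξ • z ξ)
        = (Iio s).indicator fun ξ => (t - s) ^ (ρ - 1) • ((s - ξ) ^ (-ρ) • z ξ) := by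
      ext ξ
      simp only [hK, indicator, mem_Iio]
      split_ifs
      · rw [mul_smul]
      · rw [zero_smul]
    have h2 : Iio s ∩ Ioc 0 t = Ioo 0 s := by
      ext ξ
      simp only [mem_inter_iff, mem_Iio, mem_Ioc, mem_Ioo]
      exact ⟨fun h => ⟨h.2.1, h.1⟩, fun h => ⟨h.2, h.1, h.2.le.trans hs.2⟩⟩
    rw [h1, integral_indicator measurableSet_Iio, Measure.restrict_restrict measurableSet_Iio, h2,
      integral_smul, intervalIntegral.integral_of_le hs.1.le, restrict_Ioo_eq_restrict_Ioc]
  rw [hL, hswap, intervalIntegral.integral_of_le ht.le, ← integral_smul]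
  refine integral_congr_ae (hae.mono fun ξ hξ => ?_)
  simp only
  rw [integral_smul_const, hKv ξ hξ]

theorem FracIntegrableAt.integrableOn {ρ t : ℝ} (hρ : 0 < ρ) (hρ1 : ρ < 1) (ht : 0 < t)
    {z : ℝ → E} (hz : FracIntegrableAt (1 - ρ) z t) : IntegrableOn z (Ioc 0 t) := by
  have h1 := hz (sub_pos.2 hρ1).ne'
  have h2 := h1.continuousOn_smul (f := fun ξ => (t - ξ) ^ ρ)
    ((continuousOn_const.sub continuousOn_id).rpow_const fun x _ => Or.inr hρ.le)
  have h3 := (intervalIntegrable_iff_integrableOn_Ioo_of_le ht.le).1 h2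
  rw [integrableOn_Ioc_iff_integrableOn_Ioo]
  refine h3.congr_fun (fun ξ hξ => ?_) measurableSet_Ioo
  have h4 : 0 < t - ξ := sub_pos.2 hξ.2
  simp only [smul_smul]
  rw [← Real.rpow_add h4, show ρ + (1 - ρ - 1) = 0 by ring, Real.rpow_zero, one_smul]

/-- With G the primitive of z, integrating the equation gives Z = -l G. Since the integrals of
orders ρ and 1 - ρ compose to order 1, applying the one of order ρ gives G = -l I^ρ G. Working with
G avoids the possible singularity of z at 0. -/
theorem eqOn_zero_of_fracIntegral_relaxation [CompleteSpace E] {ρ l T : ℝ} (hρ : 0 < ρ)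
    (hρ1 : ρ ≤ 1) (hl : 0 < l) (hT : 0 < T) {z : ℝ → E}
    (hzI : ∀ t ∈ Ioc 0 T, FracIntegrableAt (1 - ρ) z t)
    (hd : ∀ t ∈ Ioc 0 T, HasDerivWithinAt (fracIntegral (1 - ρ) z) (-(l • z t)) (Ioc 0 T) t)
    (h0 : Tendsto (fracIntegral (1 - ρ) z) (𝓝[>] 0) (𝓝 0)) :
    ∀ t ∈ Ioc 0 T, z t = 0 := by
  set Z := fracIntegral (1 - ρ) z with hZ
  -- For ρ = 1 the value of Z at 0 is the arbitrary z 0, so it is replaced by the limit.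
  have hZc : ContinuousOn (Function.update Z 0 0) (Icc 0 T) := by
    rw [continuousOn_update_iff]
    have hset : Icc 0 T \ {(0 : ℝ)} = Ioc 0 T := by
      ext x
      simp only [Set.mem_sdiff, mem_Icc, mem_singleton_iff, mem_Ioc]
      exact ⟨fun h => ⟨lt_of_le_of_ne h.1.1 (Ne.symm h.2), h.1.2⟩,
        fun h => ⟨⟨h.1.le, h.2⟩, h.1.ne'⟩⟩
    rw [hset]
    exact ⟨fun t ht => (hd t ht).continuousWithinAt,
      fun _ => h0.mono_left (nhdsWithin_mono _ Ioc_subset_Ioi_self)⟩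
  have hzint : IntegrableOn z (Ioc 0 T) := by
    rcases hρ1.eq_or_lt with rfl | h1
    · have h2 : ∀ t, Z t = z t := fun t => by simp [hZ, fracIntegral]
      refine ((hZc.integrableOn_Icc).mono_set Ioc_subset_Icc_self).congr_fun (fun t ht => ?_)
        measurableSet_Ioc
      rw [Function.update_of_ne ht.1.ne', h2]
    · exact (hzI T ⟨hT, le_rfl⟩).integrableOn hρ h1 hT
  set G : ℝ → E := fun t => ∫ ξ in (0 : ℝ)..t, z ξ with hGdef
  have hZG : ∀ t ∈ Ioc 0 T, Z t = -(l • G t) := by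
    intro t ht
    have hsub : Ioc 0 t ⊆ Ioc 0 T := Ioc_subset_Ioc_right ht.2
    have h1 := intervalIntegral.integral_eq_sub_of_hasDerivAt_of_le ht.1.le
      (hZc.mono (Icc_subset_Icc_right ht.2)) (f' := fun s => -(l • z s)) (fun s hs => ?_)
      ((intervalIntegrable_iff_integrableOn_Ioc_of_le ht.1.le).2
        ((hzint.mono_set hsub).smul l).neg)
    · rw [Function.update_of_ne ht.1.ne', Function.update_self, sub_zero] at h1
      rw [← h1, intervalIntegral.integral_neg, intervalIntegral.integral_smul]
    · have hs' : s ∈ Ioo 0 T := ⟨hs.1, hs.2.trans_le ht.2⟩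
      have h2 := (hd s ⟨hs'.1, hs'.2.le⟩).hasDerivAt (Ioc_mem_nhds hs'.1 hs'.2)
      refine h2.congr_of_eventuallyEq ?_
      filter_upwards [lt_mem_nhds hs.1] with y hy
      rw [Function.update_of_ne (ne_of_gt hy)]
  have hGc : ContinuousOn G (Icc 0 T) := by
    have := intervalIntegral.continuousOn_primitive_interval (μ := volume) (f := z) (a := 0) (b := T)
      (by rwa [uIcc_of_le hT.le, integrableOn_Icc_iff_integrableOn_Ioc])
    rwa [uIcc_of_le hT.le] at this
  have hΓ := Real.Gamma_pos_of_pos hρ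
  have hGeq : ∀ t ∈ Ioc 0 T,
      G t = -((l / Real.Gamma ρ) • ∫ s in (0 : ℝ)..t, (t - s) ^ (ρ - 1) • G s) := by
    intro t ht
    have h2 : ∫ s in (0 : ℝ)..t, (t - s) ^ (ρ - 1) • Z s
        = -(l • ∫ s in (0 : ℝ)..t, (t - s) ^ (ρ - 1) • G s) := by
      rw [← intervalIntegral.integral_smul, ← intervalIntegral.integral_neg,
        intervalIntegral.integral_of_le ht.1.le, intervalIntegral.integral_of_le ht.1.le]
      refine setIntegral_congr_fun measurableSet_Ioc fun s hs => ?_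
      rw [hZG s ⟨hs.1, hs.2.trans ht.2⟩, smul_neg, smul_comm]
    have h3 : ∫ s in (0 : ℝ)..t, (t - s) ^ (ρ - 1) • Z s = Real.Gamma ρ • G t := by
      rcases hρ1.eq_or_lt with rfl | h1
      · simp [hZ, fracIntegral, hGdef]
      · have hΓ1 := Real.Gamma_pos_of_pos (sub_pos.2 h1)
        have h4 := integral_sub_rpow_smul_integral hρ h1 ht.1
          (hzint.mono_set (Ioc_subset_Ioc_right ht.2))
        simp only [hZ, fracIntegral, if_neg (sub_pos.2 h1).ne']
        rw [show 1 - ρ - 1 = -ρ by ring]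
        simp only [smul_comm _ (Real.Gamma (1 - ρ))⁻¹]
        rw [intervalIntegral.integral_smul, h4, smul_smul]
        congr 1
        field_simp
    rw [h2] at h3
    rw [div_eq_inv_mul, mul_smul, ← smul_neg, h3, smul_smul, inv_mul_cancel₀ hΓ.ne', one_smul]
  have hG0 := eqOn_zero_of_norm_le_integral hρ (div_pos hl hΓ).le hT hGc
    (by simp [hGdef]) fun t ht => by
      conv_lhs => rw [hGeq t ht]
      rw [norm_neg, norm_smul, Real.norm_of_nonneg (div_pos hl hΓ).le]
      refine mul_le_mul_of_nonneg_left ?_ (div_pos hl hΓ).le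
      refine (intervalIntegral.norm_integral_le_integral_norm ht.1.le).trans (le_of_eq ?_)
      rw [intervalIntegral.integral_of_le ht.1.le, intervalIntegral.integral_of_le ht.1.le]
      refine setIntegral_congr_fun measurableSet_Ioc fun s hs => ?_
      rw [norm_smul, Real.norm_of_nonneg (Real.rpow_nonneg (sub_nonneg.2 hs.2) _)]
  intro t ht
  -- Z vanishes identically, so comparing derivatives gives z = 0 at every point, not just almost
  -- everywhere.
  have h1 : HasDerivWithinAt Z 0 (Ioc 0 T) t := by
    refine (hasDerivWithinAt_const t (Ioc 0 T) (0 : E)).congr (fun s hs => ?_) ?_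
    · rw [hZG s hs, hG0 s ⟨hs.1.le, hs.2⟩, smul_zero, neg_zero]
    · rw [hZG t ht, hG0 t ⟨ht.1.le, ht.2⟩, smul_zero, neg_zero]
  have huniq : UniqueDiffWithinAt ℝ (Ioc 0 T) t := uniqueDiffOn_Ioc 0 T t ht
  have h2 := huniq.eq_deriv _ (hd t ht) h1
  exact (smul_eq_zero.1 (neg_eq_zero.1 h2)).resolve_left hl.ne'

end Volterra

/-! ### Diagonal operators in a Hilbert basis -/

section Diagonal

variable {𝕜 H ι : Type*} [RCLike 𝕜] [NormedAddCommGroup H] [InnerProductSpace 𝕜 H]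

theorem HilbertBasis.ext_inner (v : HilbertBasis ι 𝕜 H) {x y : H}
    (h : ∀ i, inner 𝕜 (v i) x = inner 𝕜 (v i) y) : x = y := by
  apply v.repr.injective
  ext i
  rw [v.repr_apply_apply, v.repr_apply_apply, h]

theorem HilbertBasis.hasSum_norm_inner_sq (v : HilbertBasis ι 𝕜 H) (x : H) :
    HasSum (fun i => ‖inner 𝕜 (v i) x‖ ^ 2) (‖x‖ ^ 2) := by
  have h := lp.hasSum_norm (p := 2) (by norm_num) (v.repr x)
  simpa [v.repr_apply_apply] using h

variable [NormedSpace ℝ H]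

/-- The value at `x` of the operator that is diagonal in the Hilbert basis `v`, with real
eigenvalues `c`. -/
noncomputable def diagonalSum (v : HilbertBasis ι 𝕜 H) (c : ι → ℝ) (x : H) : H :=
  ∑' i, c i • (inner 𝕜 (v i) x • v i)

theorem real_smul_inner_smul (v : HilbertBasis ι 𝕜 H) (c : ℝ) (x : H) (i : ι) :
    c • (inner 𝕜 (v i) x • v i) = ((c : 𝕜) * inner 𝕜 (v i) x) • v i := by
  rw [← smul_assoc, RCLike.real_smul_eq_coe_mul]

variable {v : HilbertBasis ι 𝕜 H} {c : ι → ℝ} {C : ℝ}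

theorem hasSum_diagonalSum_and_inner (hc : ∀ i, |c i| ≤ C) (x : H) :
    HasSum (fun i => c i • (inner 𝕜 (v i) x • v i)) (diagonalSum v c x) ∧
      ∀ i, inner 𝕜 (v i) (diagonalSum v c x) = (c i : 𝕜) * inner 𝕜 (v i) x := by
  have hmem : Memℓp (fun i => (c i : 𝕜) * inner 𝕜 (v i) x) 2 := by
    refine memℓp_gen ?_
    refine Summable.of_nonneg_of_le (fun i => by positivity) (fun i => ?_)
      ((v.hasSum_norm_inner_sq x).summable.mul_left (C ^ 2))
    have h1 : |c i| ^ 2 ≤ C ^ 2 := pow_le_pow_left₀ (abs_nonneg _) (hc i) 2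
    simp only [ENNReal.toReal_ofNat, Real.rpow_ofNat, norm_mul, RCLike.norm_ofReal, mul_pow]
    gcongr
  have h := v.hasSum_repr_symm ⟨_, hmem⟩
  simp only [← real_smul_inner_smul] at h
  have heq : diagonalSum v c x = v.repr.symm ⟨_, hmem⟩ := h.tsum_eq
  refine ⟨heq ▸ h, fun i => ?_⟩
  rw [heq, ← v.repr_apply_apply, LinearIsometryEquiv.apply_symm_apply]

theorem hasSum_diagonalSum (hc : ∀ i, |c i| ≤ C) (x : H) :
    HasSum (fun i => c i • (inner 𝕜 (v i) x • v i)) (diagonalSum v c x) :=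
  (hasSum_diagonalSum_and_inner hc x).1

theorem inner_diagonalSum (hc : ∀ i, |c i| ≤ C) (x : H) (i : ι) :
    inner 𝕜 (v i) (diagonalSum v c x) = (c i : 𝕜) * inner 𝕜 (v i) x :=
  (hasSum_diagonalSum_and_inner hc x).2 i

theorem norm_diagonalSum_le (hc : ∀ i, |c i| ≤ C) (hC : 0 ≤ C) (x : H) :
    ‖diagonalSum v c x‖ ≤ C * ‖x‖ := by
  refine (pow_le_pow_iff_left₀ (norm_nonneg _) (by positivity) two_ne_zero).1 ?_
  rw [mul_pow]
  refine hasSum_le (fun i => ?_) (v.hasSum_norm_inner_sq _)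
    ((v.hasSum_norm_inner_sq x).mul_left (C ^ 2))
  rw [inner_diagonalSum hc, norm_mul, RCLike.norm_ofReal, mul_pow]
  have h1 : |c i| ^ 2 ≤ C ^ 2 := pow_le_pow_left₀ (abs_nonneg _) (hc i) 2
  gcongr

/-- By Parseval the squared distance is a sum dominated by (2C)² ‖(v i, x)‖². Only coefficientwise
convergence is needed, given the uniform bound. -/
theorem tendsto_diagonalSum {α : Type*} {l : Filter α} {c : α → ι → ℝ} {c₀ : ι → ℝ}
    (hc : ∀ᶠ a in l, ∀ i, |c a i| ≤ C) (hc₀ : ∀ i, |c₀ i| ≤ C)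
    (h : ∀ i, Tendsto (fun a => c a i) l (𝓝 (c₀ i))) (x : H) :
    Tendsto (fun a => diagonalSum v (c a) x) l (𝓝 (diagonalSum v c₀ x)) := by
  rw [tendsto_iff_norm_sub_tendsto_zero]
  have hsq : Tendsto (fun a => ∑' i, (|c a i - c₀ i| * ‖inner 𝕜 (v i) x‖) ^ 2) l
      (𝓝 (∑' i : ι, (0 : ℝ))) := by
    refine tendsto_tsum_of_dominated_convergence
      (bound := fun i => (2 * C) ^ 2 * ‖inner 𝕜 (v i) x‖ ^ 2)
      ((v.hasSum_norm_inner_sq x).summable.mul_left _) (fun i => ?_) (hc.mono fun a ha i => ?_)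
    · have h1 := (((h i).sub_const (c₀ i)).abs.mul_const ‖inner 𝕜 (v i) x‖).pow 2
      simpa using h1
    · rw [Real.norm_of_nonneg (by positivity), mul_pow]
      have h2 : |c a i - c₀ i| ≤ 2 * C := (abs_sub _ _).trans (by linarith [ha i, hc₀ i])
      gcongr
  rw [tsum_zero] at hsq
  have h3 := hsq.sqrt
  rw [Real.sqrt_zero] at h3
  refine h3.congr' (hc.mono fun a ha => ?_)
  have h4 := v.hasSum_norm_inner_sq (diagonalSum v (c a) x - diagonalSum v c₀ x)
  have h5 : ∀ i, ‖inner 𝕜 (v i) (diagonalSum v (c a) x - diagonalSum v c₀ x)‖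
      = |c a i - c₀ i| * ‖inner 𝕜 (v i) x‖ := fun i => by
    rw [inner_sub_right, inner_diagonalSum ha, inner_diagonalSum hc₀, ← sub_mul, norm_mul,
      ← RCLike.ofReal_sub, RCLike.norm_ofReal]
  simp only [h5] at h4
  rw [h4.tsum_eq, Real.sqrt_sq (norm_nonneg _)]

end Diagonal

/-! ### Self-adjoint operators with an eigenbasis -/

section SelfAdjoint

variable {𝕜 H ι : Type*} [RCLike 𝕜] [NormedAddCommGroup H] [InnerProductSpace 𝕜 H]
  {A : H →ₗ.[𝕜] H} {v : HilbertBasis ι 𝕜 H} {lam : ι → ℝ}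

theorem eigenvalue_pos (hpos : ∀ x : A.domain, x ≠ 0 → 0 < RCLike.re (inner 𝕜 (A x) (x : H)))
    (hv : ∀ i, ∃ hi : v i ∈ A.domain, A ⟨v i, hi⟩ = (lam i : 𝕜) • v i) (i : ι) : 0 < lam i := by
  obtain ⟨hi, h⟩ := hv i
  have hn : ‖v i‖ = 1 := v.orthonormal.1 i
  have h0 : (⟨v i, hi⟩ : A.domain) ≠ 0 := fun h0 => by
    have : v i = 0 := congrArg Subtype.val h0
    rw [this, norm_zero] at hn
    exact zero_ne_one hn
  have h1 := hpos _ h0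
  rw [h, inner_smul_left, RCLike.conj_ofReal, RCLike.re_ofReal_mul, inner_self_eq_norm_sq, hn] at h1
  simpa using h1

variable [CompleteSpace H]

theorem inner_eigenvector_apply (hA : IsSelfAdjoint A)
    (hv : ∀ i, ∃ hi : v i ∈ A.domain, A ⟨v i, hi⟩ = (lam i : 𝕜) • v i) (x : A.domain) (i : ι) :
    inner 𝕜 (v i) (A x) = (lam i : 𝕜) * inner 𝕜 (v i) (x : H) := by
  obtain ⟨hi, h⟩ := hv i
  have h1 := A.adjoint_isFormalAdjoint hA.dense_domain
  rw [LinearPMap.isSelfAdjoint_def.1 hA] at h1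
  have h2 := h1 x ⟨v i, hi⟩
  rw [← inner_conj_symm, h2, h, inner_conj_symm, inner_smul_left, RCLike.conj_ofReal]

/-- Parseval gives (w, y) = (x, Ay) for all y in D(A), so x lies in D(A*), and D(A*) = D(A). Mere
symmetry would not suffice. -/
theorem exists_mem_domain_apply_eq (hA : IsSelfAdjoint A)
    (hv : ∀ i, ∃ hi : v i ∈ A.domain, A ⟨v i, hi⟩ = (lam i : 𝕜) • v i) {x w : H}
    (h : ∀ i, inner 𝕜 (v i) w = (lam i : 𝕜) * inner 𝕜 (v i) x) :
    ∃ hx : x ∈ A.domain, A ⟨x, hx⟩ = w := by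
  have hx : x ∈ A.domain := by
    rw [← LinearPMap.isSelfAdjoint_def.1 hA]
    refine A.mem_adjoint_domain_of_exists x ⟨w, fun y => ?_⟩
    rw [← v.tsum_inner_mul_inner w y, ← v.tsum_inner_mul_inner x (A y)]
    refine tsum_congr fun i => ?_
    rw [inner_eigenvector_apply hA hv, ← inner_conj_symm w, h, map_mul, RCLike.conj_ofReal,
      inner_conj_symm]
    ring
  refine ⟨hx, v.ext_inner fun i => ?_⟩
  rw [inner_eigenvector_apply hA hv, h]

end SelfAdjoint

theorem fracIntegral_sub {E : Type*} [NormedAddCommGroup E] [NormedSpace ℝ E] {σ t : ℝ}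
    {f g : ℝ → E} (hf : FracIntegrableAt σ f t) (hg : FracIntegrableAt σ g t) :
    fracIntegral σ (fun s => f s - g s) t = fracIntegral σ f t - fracIntegral σ g t := by
  unfold fracIntegral
  split_ifs with h
  · rfl
  · simp only [smul_sub]
    rw [intervalIntegral.integral_sub (hf h) (hg h), smul_sub]

theorem FracIntegrableAt.sub {E : Type*} [NormedAddCommGroup E] [NormedSpace ℝ E] {σ t : ℝ}
    {f g : ℝ → E} (hf : FracIntegrableAt σ f t) (hg : FracIntegrableAt σ g t) :
    FracIntegrableAt σ (fun s => f s - g s) t := by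
  intro h
  simpa only [smul_sub] using (hf h).sub (hg h)

/-! ### The forward problem -/

section Forward

variable {𝕜 H ι : Type*} [RCLike 𝕜] [NormedAddCommGroup H] [InnerProductSpace 𝕜 H]
  [NormedSpace ℝ H]

variable (𝕜) in
/-- The inner product with a fixed vector as a real-linear map. -/
noncomputable def innerRealCLM (x : H) : H →L[ℝ] 𝕜 := (innerSL 𝕜 x).restrictScalars ℝ

theorem innerRealCLM_apply (x y : H) : innerRealCLM 𝕜 x y = inner 𝕜 x y := rfl

variable {A : H →ₗ.[𝕜] H} {v : HilbertBasis ι 𝕜 H} {lam : ι → ℝ} {ρ T : ℝ} {φ : H}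

/-- The candidate solution of the forward problem. -/
noncomputable def forwardSeries (v : HilbertBasis ι 𝕜 H) (lam : ι → ℝ) (ρ : ℝ) (φ : H) (t : ℝ) :
    H := diagonalSum v (fun i => mlRelaxation ρ ρ (lam i) t) φ

/-- The image of the candidate solution under the operator. -/
noncomputable def forwardSeriesImage (v : HilbertBasis ι 𝕜 H) (lam : ι → ℝ) (ρ : ℝ) (φ : H)
    (t : ℝ) : H := diagonalSum v (fun i => lam i * mlRelaxation ρ ρ (lam i) t) φ

theorem abs_mlRelaxation_le (hρ0 : 0 < ρ) (hρ1 : ρ ≤ 1) {l t : ℝ} (hl : 0 ≤ l) (ht : 0 < t) :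
    |mlRelaxation ρ ρ l t| ≤ t ^ (ρ - 1) / Real.Gamma ρ := by
  rw [abs_of_nonneg (mlRelaxation_nonneg hρ0 hρ1 hl ht)]
  exact mlRelaxation_le hρ0 hρ1 hl ht

theorem abs_mul_mlRelaxation_le (hρ0 : 0 < ρ) (hρ1 : ρ ≤ 1) {l t : ℝ} (hl : 0 ≤ l) (ht : 0 < t) :
    |l * mlRelaxation ρ ρ l t| ≤ 1 / t := by
  rw [abs_of_nonneg (mul_nonneg hl (mlRelaxation_nonneg hρ0 hρ1 hl ht))]
  exact mul_mul_mlRelaxation_le hρ0 hρ1 hl ht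

theorem abs_mlRelaxation_one_le (hρ0 : 0 < ρ) (hρ1 : ρ ≤ 1) {l t : ℝ} (hl : 0 ≤ l) (ht : 0 < t) :
    |mlRelaxation ρ 1 l t| ≤ 1 := by
  rw [abs_of_nonneg (mlRelaxation_one_nonneg hρ0 hρ1 hl ht)]
  exact mlRelaxation_one_le hρ0 hρ1 hl ht

theorem continuousOn_forwardSeries (hρ0 : 0 < ρ) (hρ1 : ρ ≤ 1) (hl : ∀ i, 0 ≤ lam i) :
    ContinuousOn (forwardSeries v lam ρ φ) (Ioi 0) := by
  intro t ht
  have ht0 : (0 : ℝ) < t := ht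
  have hΓ := Real.Gamma_pos_of_pos hρ0
  -- On s > t/2 one bound serves every mode, which is the domination that `tendsto_diagonalSum`
  -- requires.
  have hbd : ∀ s, t / 2 < s → ∀ i, |mlRelaxation ρ ρ (lam i) s|
      ≤ (t / 2) ^ (ρ - 1) / Real.Gamma ρ := fun s hs i => by
    refine (abs_mlRelaxation_le hρ0 hρ1 (hl i) (by linarith)).trans ?_
    exact div_le_div_of_nonneg_right
      (Real.rpow_le_rpow_of_nonpos (by linarith) hs.le (by linarith)) hΓ.le
  refine ContinuousAt.continuousWithinAt (tendsto_diagonalSum ?_ (hbd t (by linarith))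
    (fun i => (continuousOn_mlRelaxation hρ0 hρ0 (lam i)).continuousAt (Ioi_mem_nhds ht0)) φ)
  filter_upwards [lt_mem_nhds (show t / 2 < t by linarith)] with s hs using hbd s hs

theorem continuousOn_forwardSeriesImage (hρ0 : 0 < ρ) (hρ1 : ρ ≤ 1) (hl : ∀ i, 0 ≤ lam i) :
    ContinuousOn (forwardSeriesImage v lam ρ φ) (Ioi 0) := by
  intro t ht
  have ht0 : (0 : ℝ) < t := ht
  have hbd : ∀ s, t / 2 < s → ∀ i, |lam i * mlRelaxation ρ ρ (lam i) s| ≤ 1 / (t / 2) :=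
    fun s hs i => (abs_mul_mlRelaxation_le hρ0 hρ1 (hl i) (by linarith)).trans
      (one_div_le_one_div_of_le (by linarith) hs.le)
  refine ContinuousAt.continuousWithinAt (tendsto_diagonalSum ?_ (hbd t (by linarith))
    (fun i => ((continuousOn_mlRelaxation hρ0 hρ0 (lam i)).continuousAt
      (Ioi_mem_nhds ht0)).const_mul (lam i)) φ)
  filter_upwards [lt_mem_nhds (show t / 2 < t by linarith)] with s hs using hbd s hs

theorem fracIntegrableAt_forwardSeries (hρ0 : 0 < ρ) (hρ1 : ρ ≤ 1) (hl : ∀ i, 0 ≤ lam i) {t : ℝ}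
    (ht : 0 < t) : FracIntegrableAt (1 - ρ) (forwardSeries v lam ρ φ) t := by
  intro hne
  have hb : 0 < 1 - ρ := lt_of_le_of_ne (by linarith) (Ne.symm hne)
  have hΓ := Real.Gamma_pos_of_pos hρ0
  have h1 := ((intervalIntegrable_iff_integrableOn_Ioo_of_le ht.le).1
    (intervalIntegrable_sub_rpow_mul_rpow hb hρ0 ht)).mul_const ((Real.Gamma ρ)⁻¹ * ‖φ‖)
  rw [intervalIntegrable_iff_integrableOn_Ioo_of_le ht.le]
  refine Integrable.mono' h1 (ContinuousOn.aestronglyMeasurable ?_ measurableSet_Ioo) ?_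
  · refine ContinuousOn.smul ?_ ((continuousOn_forwardSeries hρ0 hρ1 hl).mono fun x hx => hx.1)
    exact (continuousOn_const.sub continuousOn_id).rpow_const
      fun x hx => Or.inl (sub_pos.2 hx.2).ne'
  · filter_upwards [ae_restrict_mem measurableSet_Ioo] with ξ hξ
    have h2 : ‖forwardSeries v lam ρ φ ξ‖ ≤ ξ ^ (ρ - 1) / Real.Gamma ρ * ‖φ‖ :=
      norm_diagonalSum_le (fun i => abs_mlRelaxation_le hρ0 hρ1 (hl i) hξ.1)
        (div_nonneg (Real.rpow_nonneg hξ.1.le _) hΓ.le) φ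
    have h3 : 0 ≤ (t - ξ) ^ (1 - ρ - 1) := Real.rpow_nonneg (sub_pos.2 hξ.2).le _
    rw [norm_smul, Real.norm_of_nonneg h3]
    refine (mul_le_mul_of_nonneg_left h2 h3).trans (le_of_eq ?_)
    ring

variable [CompleteSpace H]

theorem IsForwardSolution.hasDerivWithinAt_inner {w : ℝ → H} (hw : IsForwardSolution A ρ T φ w)
    (hA : IsSelfAdjoint A)
    (hv : ∀ i, ∃ hi : v i ∈ A.domain, A ⟨v i, hi⟩ = (lam i : 𝕜) • v i) (i : ι)
    {t : ℝ} (ht : t ∈ Ioc 0 T) :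
    HasDerivWithinAt (fracIntegral (1 - ρ) fun s => innerRealCLM 𝕜 (v i) (w s))
      (-(lam i • innerRealCLM 𝕜 (v i) (w t))) (Ioc 0 T) t := by
  have h1 : HasDerivWithinAt (fracIntegral (1 - ρ) w) (rlDeriv ρ T w t) (Ioc 0 T) t :=
    (hw.differentiable t ht).hasDerivWithinAt
  have h2 := (innerRealCLM 𝕜 (v i)).hasFDerivAt.comp_hasDerivWithinAt t h1
  rw [eq_neg_of_add_eq_zero_left (hw.equation t ht), map_neg, innerRealCLM_apply,
    inner_eigenvector_apply hA hv, ← RCLike.real_smul_eq_coe_mul, ← innerRealCLM_apply] at h2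
  exact h2.congr (fun s hs => ((innerRealCLM 𝕜 (v i)).map_fracIntegral (hw.fracIntegrable s hs)).symm)
    ((innerRealCLM 𝕜 (v i)).map_fracIntegral (hw.fracIntegrable t ht)).symm

theorem IsForwardSolution.tendsto_inner {w : ℝ → H} (hw : IsForwardSolution A ρ T φ w)
    (hT : 0 < T) (x : H) :
    Tendsto (fracIntegral (1 - ρ) fun s => innerRealCLM 𝕜 x (w s)) (𝓝[>] 0)
      (𝓝 (innerRealCLM 𝕜 x φ)) := by
  refine (((innerRealCLM 𝕜 x).continuous.tendsto φ).comp hw.initial).congr' ?_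
  filter_upwards [Ioc_mem_nhdsGT hT] with t ht
  exact (innerRealCLM 𝕜 x).map_fracIntegral (hw.fracIntegrable t ht)

theorem IsForwardSolution.eqOn {w u : ℝ → H} (hw : IsForwardSolution A ρ T φ w)
    (hu : IsForwardSolution A ρ T φ u) (hA : IsSelfAdjoint A)
    (hv : ∀ i, ∃ hi : v i ∈ A.domain, A ⟨v i, hi⟩ = (lam i : 𝕜) • v i) (hl : ∀ i, 0 < lam i)
    (hρ0 : 0 < ρ) (hρ1 : ρ ≤ 1) (hT : 0 < T) : EqOn w u (Ioc 0 T) := by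
  intro t ht
  refine v.ext_inner fun i => ?_
  have hwI := fun s hs => (hw.fracIntegrable s hs).clm_comp (innerRealCLM 𝕜 (v i))
  have huI := fun s hs => (hu.fracIntegrable s hs).clm_comp (innerRealCLM 𝕜 (v i))
  have hz := eqOn_zero_of_fracIntegral_relaxation
    (z := fun s => innerRealCLM 𝕜 (v i) (w s) - innerRealCLM 𝕜 (v i) (u s)) hρ0 hρ1 (hl i) hT
    (fun s hs => (hwI s hs).sub (huI s hs))
    (fun s hs => by
      have h1 := (hw.hasDerivWithinAt_inner hA hv i hs).sub (hu.hasDerivWithinAt_inner hA hv i hs)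
      refine (h1.congr (fun r hr => fracIntegral_sub (hwI r hr) (huI r hr))
        (fracIntegral_sub (hwI s hs) (huI s hs))).congr_deriv ?_
      rw [smul_sub]
      abel)
    (by
      have h1 := (hw.tendsto_inner hT (v i)).sub (hu.tendsto_inner hT (v i))
      rw [sub_self] at h1
      refine h1.congr' ?_
      filter_upwards [Ioc_mem_nhdsGT hT] with s hs
      exact (fracIntegral_sub (hwI s hs) (huI s hs)).symm)
    t ht
  exact sub_eq_zero.1 hz

/-- Bounded functionals pass through the Bochner integral, so the coefficients reduce to
`fracIntegral_mlRelaxation`. -/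
theorem fracIntegral_forwardSeries (hρ0 : 0 < ρ) (hρ1 : ρ ≤ 1) (hl : ∀ i, 0 ≤ lam i) {t : ℝ}
    (ht : 0 < t) : fracIntegral (1 - ρ) (forwardSeries v lam ρ φ) t
      = diagonalSum v (fun i => mlRelaxation ρ 1 (lam i) t) φ := by
  refine v.ext_inner fun i => ?_
  rw [inner_diagonalSum (fun i => abs_mlRelaxation_one_le hρ0 hρ1 (hl i) ht),
    ← innerRealCLM_apply, ContinuousLinearMap.map_fracIntegral _
      (fracIntegrableAt_forwardSeries hρ0 hρ1 hl ht),
    ← fracIntegral_mlRelaxation hρ0 hρ1 (lam i) ht]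
  have hcoef : ∀ s, 0 < s → innerRealCLM 𝕜 (v i) (forwardSeries v lam ρ φ s)
      = (mlRelaxation ρ ρ (lam i) s : 𝕜) * inner 𝕜 (v i) φ := fun s hs => by
    rw [innerRealCLM_apply, forwardSeries,
      inner_diagonalSum (fun i => abs_mlRelaxation_le hρ0 hρ1 (hl i) hs)]
  unfold fracIntegral
  split_ifs with h
  · exact hcoef t ht
  · rw [smul_eq_mul, RCLike.ofReal_mul, mul_assoc, RCLike.real_smul_eq_coe_mul]
    congr 1
    rw [← RCLike.real_smul_eq_coe_mul, ← intervalIntegral.integral_smul_const,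
      intervalIntegral.integral_of_le ht.le, intervalIntegral.integral_of_le ht.le]
    refine setIntegral_congr_fun measurableSet_Ioc fun s hs => ?_
    simp only [hcoef s hs.1]
    rw [smul_eq_mul, mul_smul, RCLike.real_smul_eq_coe_mul (mlRelaxation _ _ _ _)]

/-- The integrated equation, from which differentiability follows by continuity of the integrand. It
starts at s > 0 because the available bound ‖φ‖/τ for the integrand is not integrable at 0. -/
theorem fracIntegral_forwardSeries_sub (hρ0 : 0 < ρ) (hρ1 : ρ ≤ 1) (hl : ∀ i, 0 ≤ lam i) {s t : ℝ}
    (hs : 0 < s) (ht : 0 < t) :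
    fracIntegral (1 - ρ) (forwardSeries v lam ρ φ) t
      = fracIntegral (1 - ρ) (forwardSeries v lam ρ φ) s
        - ∫ τ in s..t, forwardSeriesImage v lam ρ φ τ := by
  have hsub : uIcc s t ⊆ Ioi 0 := fun x hx => (lt_min hs ht).trans_le hx.1
  have hint : IntervalIntegrable (forwardSeriesImage v lam ρ φ) volume s t :=
    ((continuousOn_forwardSeriesImage hρ0 hρ1 hl).mono hsub).intervalIntegrable
  rw [fracIntegral_forwardSeries hρ0 hρ1 hl hs, fracIntegral_forwardSeries hρ0 hρ1 hl ht]
  refine v.ext_inner fun i => ?_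
  have h1 : ∫ τ in s..t, innerRealCLM 𝕜 (v i) (forwardSeriesImage v lam ρ φ τ)
      = ((lam i * ∫ τ in s..t, mlRelaxation ρ ρ (lam i) τ : ℝ) : 𝕜) * inner 𝕜 (v i) φ := by
    rw [← RCLike.real_smul_eq_coe_mul, ← intervalIntegral.integral_const_mul,
      ← intervalIntegral.integral_smul_const]
    refine intervalIntegral.integral_congr fun τ hτ => ?_
    rw [innerRealCLM_apply, forwardSeriesImage, inner_diagonalSum
      (fun i => abs_mul_mlRelaxation_le hρ0 hρ1 (hl i) (hsub hτ)), RCLike.real_smul_eq_coe_mul]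
  have h2 := mul_integral_mlRelaxation hρ0 (lam i) hs
  have h3 := mul_integral_mlRelaxation hρ0 (lam i) ht
  rw [← intervalIntegral.integral_add_adjacent_intervals
      (intervalIntegrable_mlRelaxation hρ0 hρ0 (lam i) hs)
      ((intervalIntegrable_mlRelaxation hρ0 hρ0 (lam i) hs).symm.trans
        (intervalIntegrable_mlRelaxation hρ0 hρ0 (lam i) ht))] at h3
  have h4 : lam i * ∫ τ in s..t, mlRelaxation ρ ρ (lam i) τ
      = mlRelaxation ρ 1 (lam i) s - mlRelaxation ρ 1 (lam i) t := by linarith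
  rw [inner_sub_right, inner_diagonalSum (fun i => abs_mlRelaxation_one_le hρ0 hρ1 (hl i) ht),
    inner_diagonalSum (fun i => abs_mlRelaxation_one_le hρ0 hρ1 (hl i) hs),
    ← innerRealCLM_apply (v i) (∫ τ in s..t, _), ← ContinuousLinearMap.intervalIntegral_comp_comm _
      hint, h1, h4, RCLike.ofReal_sub]
  ring

theorem hasDerivAt_fracIntegral_forwardSeries (hρ0 : 0 < ρ) (hρ1 : ρ ≤ 1) (hl : ∀ i, 0 ≤ lam i)
    {t : ℝ} (ht : 0 < t) :
    HasDerivAt (fracIntegral (1 - ρ) (forwardSeries v lam ρ φ)) (-forwardSeriesImage v lam ρ φ t)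
      t := by
  have hc := continuousOn_forwardSeriesImage (v := v) (φ := φ) hρ0 hρ1 hl
  have h1 : HasDerivAt (fun x => ∫ τ in t..x, forwardSeriesImage v lam ρ φ τ)
      (forwardSeriesImage v lam ρ φ t) t :=
    intervalIntegral.integral_hasDerivAt_right (by simp)
      (hc.stronglyMeasurableAtFilter isOpen_Ioi t ht) (hc.continuousAt (Ioi_mem_nhds ht))
  refine (h1.const_sub (fracIntegral (1 - ρ) (forwardSeries v lam ρ φ) t)).congr_of_eventuallyEq ?_
  filter_upwards [lt_mem_nhds ht] with x hx
  exact fracIntegral_forwardSeries_sub hρ0 hρ1 hl ht hx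

theorem tendsto_fracIntegral_forwardSeries (hρ0 : 0 < ρ) (hρ1 : ρ ≤ 1) (hl : ∀ i, 0 ≤ lam i) :
    Tendsto (fracIntegral (1 - ρ) (forwardSeries v lam ρ φ)) (𝓝[>] 0) (𝓝 φ) := by
  have hone : diagonalSum v (fun _ => (1 : ℝ)) φ = φ := v.ext_inner fun i => by
    rw [inner_diagonalSum (C := 1) (fun _ => by simp)]
    simp
  have h1 : Tendsto (fun t => diagonalSum v (fun i => mlRelaxation ρ 1 (lam i) t) φ) (𝓝[>] 0)
      (𝓝 (diagonalSum v (fun _ => (1 : ℝ)) φ)) := by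
    refine tendsto_diagonalSum (C := 1) ?_ (fun _ => by simp) (fun i => ?_) φ
    · filter_upwards [self_mem_nhdsWithin] with t ht i
      exact abs_mlRelaxation_one_le hρ0 hρ1 (hl i) ht
    · simp only [mlRelaxation_one]
      have h2 : Continuous fun t : ℝ => mittagLeffler ρ 1 (-lam i * t ^ ρ) :=
        (continuous_mittagLeffler hρ0 one_pos).comp
          (continuous_const.mul (Real.continuous_rpow_const hρ0.le))
      have h3 := h2.tendsto 0
      rw [Real.zero_rpow hρ0.ne', mul_zero, mittagLeffler_zero, Real.Gamma_one, inv_one] at h3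
      exact h3.mono_left nhdsWithin_le_nhds
  rw [hone] at h1
  refine h1.congr' ?_
  filter_upwards [self_mem_nhdsWithin] with t ht
  exact (fracIntegral_forwardSeries hρ0 hρ1 hl ht).symm

theorem isForwardSolution_forwardSeries (hA : IsSelfAdjoint A)
    (hv : ∀ i, ∃ hi : v i ∈ A.domain, A ⟨v i, hi⟩ = (lam i : 𝕜) • v i) (hl : ∀ i, 0 ≤ lam i)
    (hρ0 : 0 < ρ) (hρ1 : ρ ≤ 1) : IsForwardSolution A ρ T φ (forwardSeries v lam ρ φ) := by
  have hdom : ∀ t, 0 < t → ∃ hx : forwardSeries v lam ρ φ t ∈ A.domain,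
      A ⟨_, hx⟩ = forwardSeriesImage v lam ρ φ t := fun t ht => by
    refine exists_mem_domain_apply_eq hA hv fun i => ?_
    rw [forwardSeries, forwardSeriesImage,
      inner_diagonalSum (fun i => abs_mul_mlRelaxation_le hρ0 hρ1 (hl i) ht),
      inner_diagonalSum (fun i => abs_mlRelaxation_le hρ0 hρ1 (hl i) ht), RCLike.ofReal_mul,
      mul_assoc]
  have hder : ∀ t ∈ Ioc 0 T, rlDeriv ρ T (forwardSeries v lam ρ φ) t
      = -forwardSeriesImage v lam ρ φ t := fun t ht =>
    (hasDerivAt_fracIntegral_forwardSeries hρ0 hρ1 hl ht.1).hasDerivWithinAt.derivWithin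
      (uniqueDiffOn_Ioc 0 T t ht)
  have hcont : ContinuousOn (forwardSeriesImage v lam ρ φ) (Ioc 0 T) :=
    (continuousOn_forwardSeriesImage hρ0 hρ1 hl).mono Ioc_subset_Ioi_self
  exact
    { fracIntegrable := fun t ht => fracIntegrableAt_forwardSeries hρ0 hρ1 hl ht.1
      differentiable := fun t ht => (hasDerivAt_fracIntegral_forwardSeries hρ0 hρ1 hl
        ht.1).differentiableAt.differentiableWithinAt
      continuous_rlDeriv := hcont.neg.congr hder
      mem_domain := fun t ht => (hdom t ht.1).1
      continuous_apply := (continuousOn_iff_continuous_domRestrict.1 hcont).congr fun t =>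
        (hdom t t.2.1).2.symm
      equation := fun t ht => by rw [hder t ht, (hdom t ht.1).2, neg_add_cancel]
      initial := tendsto_fracIntegral_forwardSeries hρ0 hρ1 hl }

end Forward

theorem theorem1 {𝕜 H ι : Type*} [RCLike 𝕜] [NormedAddCommGroup H] [InnerProductSpace 𝕜 H]
    [NormedSpace ℝ H] [CompleteSpace H] [TopologicalSpace.SeparableSpace H] [Countable ι]
    (A : H →ₗ.[𝕜] H) (hA : IsSelfAdjoint A)
    (hpos : ∀ x : A.domain, x ≠ 0 → 0 < RCLike.re (inner 𝕜 (A x) (x : H)))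
    (v : HilbertBasis ι 𝕜 H) (lam : ι → ℝ)
    (hv : ∀ i, ∃ hi : v i ∈ A.domain, A ⟨v i, hi⟩ = (lam i : 𝕜) • v i)
    (ρ : ℝ) (hρ0 : 0 < ρ) (hρ1 : ρ ≤ 1) (T : ℝ) (hT : 0 < T) (φ : H) :
    ∃ u : ℝ → H, IsForwardSolution A ρ T φ u ∧
      (∀ w : ℝ → H, IsForwardSolution A ρ T φ w → EqOn w u (Ioc 0 T)) ∧
      ∀ t ∈ Ioc 0 T, HasSum
        (fun i => (t ^ (ρ - 1) * mittagLeffler ρ ρ (-(lam i) * t ^ ρ)) •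
          (inner 𝕜 (v i) φ • v i)) (u t) := by
  have hl : ∀ i, 0 < lam i := eigenvalue_pos hpos hv
  have hu := isForwardSolution_forwardSeries (T := T) (φ := φ) hA hv (fun i => (hl i).le) hρ0 hρ1
  exact ⟨forwardSeries v lam ρ φ, hu, fun w hw => hw.eqOn hu hA hv hl hρ0 hρ1 hT, fun t ht =>
    hasSum_diagonalSum (fun i => abs_mlRelaxation_le hρ0 hρ1 (hl i).le ht.1) φ⟩
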